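/- Let $\theta>0$ and $d\in\mathbb N$. Let $(\overline X_{m,k})_{m,k\ge 1}$ be independent $\mathbb R^d$-valued random vectors, $\overline X_{m,k}=(X_{m,k,1},\dots,X_{m,k,d})$, such that $\overline X_{m,k}\stackrel{d}{=}\overline X_{m,1}$ for all $m,k\ge 1$. For each $n$ let $\sigma_n$ be a random permutation of $n$ points, independent of the family $(\overline X_{m,k})_{m,k\ge1}$, with the Ewens distribution of parameter $\theta$: $$\mathbb P[\sigma_n=s]=\frac{\theta^{\ell(s)}}{\theta(\theta+1)\cdots(\theta+n-1)}\qquad(s\in S_n),$$ where $\ell(s)$ is the total number of cycles of $s$ (fixed points included). Let $C_m=C_m^{(n)}$ be the number of cycles of length $m$ of $\sigma_n$ and put $$\overline A_n:=\sum_{m=1}^n\sum_{k=1}^{C_m}\overline X_{m,k}.$$ Assume that there are real constants $V_n$ with $V_n\to\infty$, real constants $\sigma_{j,\ell}$ ($1\le j,\ell\le d$), and $p>\max\{1/\theta,2\}$ such that $\mathbb E|X_{m,1,j}|^p<\infty$ for all $m\ge1$ and $1\le j\le d$, and, as $n\to\infty$, $$\frac1{V_n}\sum_{m=1}^n\frac1m\,\mathbb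 E\bigl[X_{m,1,j}X_{m,1,\ell}\bigr]\longrightarrow\sigma_{j,\ell}\quad(1\le j,\ell\le d),\qquad \sum_{m=1}^n\frac1m\,\mathbb E\bigl|X_{m,1,j}\bigr|^p=o\bigl(V_n^{p/2}\bigr)\quad(1\le j\le d).$$ Then the matrix $\Sigma=(\sigma_{j,\ell})_{1\le j,\ell\le d}$ is positive semidefinite, every $\overline A_n$ is integrable, and $$\frac{\overline A_n-\mathbb E\,\overline A_n}{\sqrt{\theta V_n}}$$ converges in distribution, as $n\to\infty$, to the (possibly degenerate) centred normal distribution $\mathcal N(0,\Sigma)$ on $\mathbb R^d$ with covariance matrix $\Sigma$. -/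

import Mathlib

open MeasureTheory ProbabilityTheory Filter Topology Asymptotics

namespace EwensCLT

/-- The finite set of permutations of `n` points carries the discrete σ-algebra. -/
instance permMeasurableSpace (n : ℕ) : MeasurableSpace (Equiv.Perm (Fin n)) := ⊤

/-- The number `C_m` of cycles of length `m` of a permutation of `n` points
(a fixed point is a cycle of length `1`). -/
def cycleCount {n : ℕ} (m : ℕ) (s : Equiv.Perm (Fin n)) : ℕ :=
  s.partition.parts.count m

/-- The total number of cycles of a permutation of `n` points, fixed points included. -/
def totalCycles {n : ℕ} (s : Equiv.Perm (Fin n)) : ℕ :=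
  s.partition.parts.card

/-- The Ewens probability of a permutation of `n` points:
`θ ^ (number of cycles) / (θ (θ + 1) ⋯ (θ + n - 1))`. -/
noncomputable def ewensWeight (θ : ℝ) {n : ℕ} (s : Equiv.Perm (Fin n)) : ℝ :=
  θ ^ totalCycles s / ∏ i ∈ Finset.range n, (θ + i)

/-- The random permutation `τ` of `n` points has the Ewens distribution with parameter `θ`. -/
structure IsEwens {Ω : Type*} [MeasurableSpace Ω] (P : Measure Ω) (θ : ℝ) {n : ℕ}
    (τ : Ω → Equiv.Perm (Fin n)) : Prop where
  measurable : Measurable τ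
  prob_eq : ∀ s : Equiv.Perm (Fin n), P (τ ⁻¹' {s}) = ENNReal.ofReal (ewensWeight θ s)

/-- The random sum `A_n = ∑_{m=1}^n ∑_{k=1}^{C_m} X_{m,k}`, where `C_m` is the number of
cycles of length `m` of the random permutation `τ` of `n` points. -/
noncomputable def cycleSum {Ω : Type*} {d n : ℕ} (τ : Ω → Equiv.Perm (Fin n))
    (X : ℕ → ℕ → Ω → EuclideanSpace ℝ (Fin d)) (ω : Ω) : EuclideanSpace ℝ (Fin d) :=
  ∑ m ∈ Finset.Icc 1 n, ∑ k ∈ Finset.Icc 1 (cycleCount m (τ ω)), X m k ω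

end EwensCLT

/-!
Removing a cycle from a permutation shows that the generating function of the Ewens cycle counts
`(C_m)` satisfies the renewal recursion of the Feller coupling. Letting the size grow identifies
the limit law of the counts, independent Poisson variables of means `θ / m`, and the recursion
controls the error: replacing the counts up to `n` by the Poisson variables changes the
characteristic function of the cycle sum by at most a multiple of `∑ w_{n,m} E|X_m|`, where the
weights `w_{n,m}` are of order `1 / n` away from `m = n` and have an integrable singularity there
when `θ < 1`. Hölder's inequality with exponent `p > 1 / θ` turns this into a power of
`∑ E|X_m|^p / m`, which vanishes after normalization. The Poissonized sum is compound Poisson, and a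
Lyapunov expansion of its characteristic exponent gives the Gaussian limit of every projection.
-/

namespace EwensCLT

/-! ### Cycle counts and the exponential formula -/

section Partition

/-- The order `∏ i, i ^ cᵢ * cᵢ!` of the centralizer of a permutation with `cᵢ` cycles of
length `i`, the multiset `s` of all cycle lengths including the fixed points. -/
def centralizerCard (s : Multiset ℕ) : ℕ := s.prod * ∏ i ∈ s.toFinset, (s.count i).factorial

lemma centralizerCard_cons (m : ℕ) (s : Multiset ℕ) :
    centralizerCard (m ::ₘ s) = m * (s.count m + 1) * centralizerCard s := by
  have extend_support : ∏ i ∈ s.toFinset, (s.count i).factorial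
      = ∏ i ∈ insert m s.toFinset, (s.count i).factorial := by
    refine Finset.prod_subset (Finset.subset_insert _ _) fun i _ hi ↦ ?_
    rw [Multiset.count_eq_zero_of_notMem (by simpa using hi), Nat.factorial_zero]
  have away_from_m : ∏ i ∈ (insert m s.toFinset).erase m, ((m ::ₘ s).count i).factorial
      = ∏ i ∈ (insert m s.toFinset).erase m, (s.count i).factorial :=
    Finset.prod_congr rfl fun i hi ↦ by
      rw [Multiset.count_cons_of_ne (Finset.ne_of_mem_erase hi)]
  rw [centralizerCard, centralizerCard, Multiset.toFinset_cons, Multiset.prod_cons,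
    extend_support, ← Finset.mul_prod_erase _ _ (Finset.mem_insert_self m s.toFinset), away_from_m,
    ← Finset.mul_prod_erase _ _ (Finset.mem_insert_self m s.toFinset), Multiset.count_cons_self,
    Nat.factorial_succ]
  ring

lemma centralizerCard_add_replicate_one {s : Multiset ℕ} (hs : s.count 1 = 0) (k : ℕ) :
    centralizerCard (s + Multiset.replicate k 1) = k.factorial * centralizerCard s := by
  induction k with
  | zero => simp
  | succ k ih =>
    rw [Multiset.replicate_succ, Multiset.add_cons, centralizerCard_cons, ih, Multiset.count_add,
      hs, Multiset.count_replicate_self, Nat.factorial_succ]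
    ring

lemma centralizerCard_pos {s : Multiset ℕ} (hs : ∀ i ∈ s, 0 < i) : 0 < centralizerCard s :=
  Nat.mul_pos (Multiset.prod_pos hs) (Finset.prod_pos fun _ _ ↦ Nat.factorial_pos _)

lemma parts_eq_filter_two_le_add_replicate {n : ℕ} (p : n.Partition) :
    p.parts = p.parts.filter (2 ≤ ·)
      + Multiset.replicate (n - (p.parts.filter (2 ≤ ·)).sum) 1 := by
  have ones : p.parts.filter (fun i ↦ ¬ 2 ≤ i)
      = Multiset.replicate (p.parts.filter (fun i ↦ ¬ 2 ≤ i)).card 1 := by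
    refine Multiset.eq_replicate_card.2 fun i hi ↦ ?_
    have := p.parts_pos (Multiset.mem_of_mem_filter hi)
    have := Multiset.of_mem_filter hi
    omega
  have split := Multiset.filter_add_not (2 ≤ ·) p.parts
  have split_sum := congrArg Multiset.sum split
  rw [Multiset.sum_add, ones, Multiset.sum_replicate, p.parts_sum, smul_eq_mul, mul_one]
    at split_sum
  conv_lhs => rw [← split, ones]
  congr 2
  omega

lemma parts_partition_eq_iff_cycleType_eq {n : ℕ} (s : Equiv.Perm (Fin n)) (p : n.Partition) :
    s.partition.parts = p.parts ↔ s.cycleType = p.parts.filter (2 ≤ ·) := by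
  constructor <;> intro h
  · rw [← h, Equiv.Perm.filter_parts_partition_eq_cycleType]
  · rw [Equiv.Perm.parts_partition, parts_eq_filter_two_le_add_replicate p, ← h,
      ← Equiv.Perm.sum_cycleType, Fintype.card_fin]

lemma card_parts_partition_eq_mul_centralizerCard {n : ℕ} (p : n.Partition) :
    (Finset.univ.filter fun s : Equiv.Perm (Fin n) ↦ s.partition.parts = p.parts).card
      * centralizerCard p.parts = n.factorial := by
  have hle : (p.parts.filter (2 ≤ ·)).sum ≤ n := by
    have h := congrArg Multiset.sum (Multiset.filter_add_not (2 ≤ ·) p.parts)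
    rw [Multiset.sum_add, p.parts_sum] at h
    omega
  have card_class := Equiv.Perm.card_of_cycleType_mul_eq (Fin n) (p.parts.filter (2 ≤ ·))
  rw [if_pos ⟨by simpa using hle, fun a ha ↦ Multiset.of_mem_filter ha⟩, Fintype.card_fin]
    at card_class
  simp_rw [parts_partition_eq_iff_cycleType_eq]
  rw [← card_class, parts_eq_filter_two_le_add_replicate p,
    centralizerCard_add_replicate_one (by simp), ← parts_eq_filter_two_le_add_replicate p,
    centralizerCard]
  ring

end Partition

section CycleIndex

variable {K : Type*} [Field K]

/-- The mean of `F` at the multiset of cycle lengths, fixed points included, of a uniformly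
distributed permutation of `n` points. -/
def cycleAverage (n : ℕ) (F : Multiset ℕ → K) : K :=
  (∑ s : Equiv.Perm (Fin n), F s.partition.parts) / n.factorial

/-- The cycle index of the symmetric group on `n` points, with the variable `x m` for the cycles
of length `m`. -/
def cycleIndex (x : ℕ → K) (n : ℕ) : K :=
  cycleAverage n fun s ↦ (s.map x).prod

lemma cycleIndex_zero (x : ℕ → K) : cycleIndex x 0 = 1 := by
  have h : (Equiv.Perm.partition (1 : Equiv.Perm (Fin 0))).parts = 0 :=
    Nat.Partition.partition_zero_parts _
  simp [cycleIndex, cycleAverage, h]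

lemma cycleIndex_congr {x y : ℕ → K} {n : ℕ} (h : ∀ m ∈ Finset.Icc 1 n, x m = y m) :
    cycleIndex x n = cycleIndex y n := by
  refine congrArg (· / _) (Finset.sum_congr rfl fun s _ ↦ congrArg _ ?_)
  refine Multiset.map_congr rfl fun m hm ↦ h m (Finset.mem_Icc.2 ⟨s.partition.parts_pos hm, ?_⟩)
  simpa using s.partition.le_of_mem_parts hm

lemma natCast_mul_prod_map_parts {n : ℕ} (s : Equiv.Perm (Fin n)) (x : ℕ → K) :
    n * (s.partition.parts.map x).prod = ∑ m ∈ Finset.Icc 1 n,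
      m * x m * (s.partition.parts.count m * ((s.partition.parts.erase m).map x).prod) := by
  have hsum : (n : K) = ∑ m ∈ s.partition.parts.toFinset, s.partition.parts.count m * (m : K) := by
    have h := (Fintype.card_fin n).symm.trans
      (s.partition.parts_sum.symm.trans (Finset.sum_multiset_count _))
    exact_mod_cast congrArg (Nat.cast : ℕ → K) h
  rw [hsum, Finset.sum_mul]
  refine (Finset.sum_congr rfl fun m hm ↦ ?_).trans
    (Finset.sum_subset (fun m hm ↦ ?_) fun m _ hm ↦ ?_)
  · rw [← Multiset.prod_map_erase (f := x) (Multiset.mem_toFinset.1 hm)]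
    ring
  · have hm' := Multiset.mem_toFinset.1 hm
    exact Finset.mem_Icc.2
      ⟨s.partition.parts_pos hm', by simpa using s.partition.le_of_mem_parts hm'⟩
  · rw [Multiset.count_eq_zero_of_notMem (by simpa using hm)]
    simp

variable [CharZero K]

lemma centralizerCard_parts_ne_zero {n : ℕ} (p : n.Partition) :
    (centralizerCard p.parts : K) ≠ 0 :=
  Nat.cast_ne_zero.2 (centralizerCard_pos fun _ hi ↦ p.parts_pos hi).ne'

lemma cycleAverage_eq_sum_partition (n : ℕ) (F : Multiset ℕ → K) :
    cycleAverage n F = ∑ p : n.Partition, F p.parts / centralizerCard p.parts := by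
  classical
  let type : Equiv.Perm (Fin n) → n.Partition := fun s ↦
    ⟨s.partition.parts, s.partition.parts_pos, by rw [s.partition.parts_sum, Fintype.card_fin]⟩
  have type_eq_iff : ∀ s p, type s = p ↔ s.partition.parts = p.parts :=
    fun s p ↦ Nat.Partition.ext_iff
  rw [cycleAverage, ← Finset.sum_fiberwise (s := Finset.univ) (g := type), Finset.sum_div]
  refine Finset.sum_congr rfl fun p _ ↦ ?_
  rw [Finset.sum_congr rfl (g := fun _ ↦ F p.parts)
    (fun s hs ↦ by rw [(type_eq_iff s p).1 (Finset.mem_filter.1 hs).2]), Finset.sum_const,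
    nsmul_eq_mul]
  simp_rw [type_eq_iff]
  have hn : (n.factorial : K) ≠ 0 := Nat.cast_ne_zero.2 n.factorial_ne_zero
  have hz : (centralizerCard p.parts : K) ≠ 0 := centralizerCard_parts_ne_zero p
  rw [div_eq_div_iff hn hz, ← card_parts_partition_eq_mul_centralizerCard p]
  push_cast
  ring

-- Adding a part `m` to a partition multiplies `centralizerCard` by `m` times the new multiplicity.
lemma cycleAverage_count_mul_erase {n m : ℕ} (hm : 1 ≤ m) (hmn : m ≤ n) (F : Multiset ℕ → K) :
    cycleAverage n (fun s ↦ s.count m * F (s.erase m)) = cycleAverage (n - m) F / m := by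
  classical
  have only_with_part : cycleAverage n (fun s ↦ s.count m * F (s.erase m))
      = ∑ p : {p : n.Partition // m ∈ p.parts},
        (p.1.parts.count m * F (p.1.parts.erase m)) / centralizerCard p.1.parts := by
    rw [cycleAverage_eq_sum_partition,
      ← Finset.sum_subtype (Finset.univ.filter fun p : n.Partition ↦ m ∈ p.parts)
      (by simp) (fun p : n.Partition ↦
        (p.parts.count m * F (p.parts.erase m)) / (centralizerCard p.parts : K))]
    refine (Finset.sum_subset (Finset.filter_subset _ _) fun p _ hp ↦ ?_).symm
    rw [Multiset.count_eq_zero_of_notMem (by simpa using hp)]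
    simp
  rw [only_with_part, ← Equiv.sum_comp (Nat.Partition.partitionWithPartEquiv hm hmn).symm,
    cycleAverage_eq_sum_partition, Finset.sum_div]
  refine Finset.sum_congr rfl fun p _ ↦ ?_
  rw [Nat.Partition.partitionWithPartEquiv_symm_apply_parts, Multiset.erase_cons_head,
    Multiset.count_cons_self, centralizerCard_cons]
  have hz : (centralizerCard p.parts : K) ≠ 0 := centralizerCard_parts_ne_zero p
  have hm' : (m : K) ≠ 0 := Nat.cast_ne_zero.2 (by omega)
  have hc : (p.parts.count m + 1 : K) ≠ 0 := Nat.cast_add_one_ne_zero _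
  push_cast
  field_simp

lemma natCast_mul_cycleIndex (x : ℕ → K) (n : ℕ) :
    n * cycleIndex x n = ∑ m ∈ Finset.Icc 1 n, x m * cycleIndex x (n - m) := by
  rw [cycleIndex, cycleAverage, ← mul_div_assoc, Finset.mul_sum]
  simp_rw [natCast_mul_prod_map_parts]
  rw [Finset.sum_comm, Finset.sum_div]
  refine Finset.sum_congr rfl fun m hm ↦ ?_
  obtain ⟨hm1, hmn⟩ := Finset.mem_Icc.1 hm
  have hm' : (m : K) ≠ 0 := Nat.cast_ne_zero.2 (by omega)
  rw [← Finset.mul_sum, mul_div_assoc]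
  have h := cycleAverage_count_mul_erase hm1 hmn fun s ↦ (s.map x).prod
  rw [cycleAverage] at h
  rw [h, cycleIndex]
  field_simp

lemma eq_cycleIndex_of_recursion {x a : ℕ → K} (h0 : a 0 = 1)
    (ha : ∀ n, n * a n = ∑ m ∈ Finset.Icc 1 n, x m * a (n - m)) : a = cycleIndex x := by
  funext n
  induction n using Nat.strong_induction_on with
  | _ n ih =>
    rcases Nat.eq_zero_or_pos n with rfl | hn
    · rw [h0, cycleIndex_zero]
    · refine mul_left_cancel₀ (Nat.cast_ne_zero.2 hn.ne' : (n : K) ≠ 0) ?_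
      rw [ha, natCast_mul_cycleIndex]
      refine Finset.sum_congr rfl fun m hm ↦ ?_
      rw [ih _ (Nat.sub_lt hn (Finset.mem_Icc.1 hm).1)]

lemma sum_Icc_mul_eq_sum_antidiagonal {R : Type*} [NonUnitalNonAssocSemiring R] (f g : ℕ → R)
    (n : ℕ) :
    ∑ m ∈ Finset.Icc 1 n, f m * g (n - m)
      = ∑ q ∈ Finset.HasAntidiagonal.antidiagonal n, (if q.1 = 0 then 0 else f q.1) * g q.2 := by
  rw [Finset.Nat.sum_antidiagonal_eq_sum_range_succ_mk, Finset.sum_range_succ',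
    ← Finset.Ico_succ_right_eq_Icc, Order.succ_eq_add_one, Finset.sum_Ico_eq_sum_range]
  simp [add_comm]

open PowerSeries in
lemma X_mul_derivative_eq_mk_mul_iff {x : ℕ → K} {f : K⟦X⟧} :
    X * derivative K f = mk (fun m ↦ if m = 0 then 0 else x m) * f
      ↔ ∀ n, n * coeff n f = ∑ m ∈ Finset.Icc 1 n, x m * coeff (n - m) f := by
  rw [PowerSeries.ext_iff]
  refine forall_congr' fun n ↦ ?_
  have coeff_left : coeff n (X * derivative K f) = n * coeff n f := by
    cases n with
    | zero => simp
    | succ n => rw [coeff_succ_X_mul, coeff_derivative]; push_cast; ring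
  rw [coeff_left, coeff_mul, sum_Icc_mul_eq_sum_antidiagonal x fun m ↦ coeff m f]
  simp only [coeff_mk]

open PowerSeries in
lemma cycleIndex_add (x y : ℕ → K) (n : ℕ) :
    cycleIndex (x + y) n
      = ∑ q ∈ Finset.HasAntidiagonal.antidiagonal n, cycleIndex x q.1 * cycleIndex y q.2 := by
  have hx := X_mul_derivative_eq_mk_mul_iff (f := mk (cycleIndex x)).2 fun n ↦ by
    simpa only [coeff_mk] using natCast_mul_cycleIndex x n
  have hy := X_mul_derivative_eq_mk_mul_iff (f := mk (cycleIndex y)).2 fun n ↦ by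
    simpa only [coeff_mk] using natCast_mul_cycleIndex y n
  have hadd : (mk fun m ↦ if m = 0 then 0 else (x + y) m)
      = (mk fun m ↦ if m = 0 then 0 else x m) + mk fun m ↦ if m = 0 then 0 else y m := by
    ext m
    by_cases hm : m = 0 <;> simp [hm]
  have hxy : X * derivative K (mk (cycleIndex x) * mk (cycleIndex y))
      = mk (fun m ↦ if m = 0 then 0 else (x + y) m)
        * (mk (cycleIndex x) * mk (cycleIndex y)) := by
    rw [hadd, Derivation.leibniz, smul_eq_mul, smul_eq_mul]
    linear_combination mk (cycleIndex y) * hx + mk (cycleIndex x) * hy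
  have hprod := eq_cycleIndex_of_recursion (by simp [cycleIndex_zero])
    (X_mul_derivative_eq_mk_mul_iff.1 hxy)
  rw [← congrFun hprod n]
  simp only [coeff_mul, coeff_mk]

lemma cycleIndex_single {m : ℕ} (hm : 1 ≤ m) (c : K) :
    cycleIndex (Pi.single m c) = fun j ↦
      if m ∣ j then (c / m) ^ (j / m) / (j / m).factorial else 0 := by
  symm
  refine eq_cycleIndex_of_recursion (by simp) fun n ↦ ?_
  have hm0 : (m : K) ≠ 0 := Nat.cast_ne_zero.2 (by omega)
  simp only [Pi.single_apply, ite_mul, zero_mul, Finset.sum_ite_eq', Finset.mem_Icc]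
  by_cases hmn : m ≤ n
  · obtain ⟨k, rfl⟩ := Nat.exists_eq_add_of_le' hmn
    simp only [hm, hmn, and_self, if_true, Nat.add_sub_cancel, Nat.dvd_add_self_right]
    split_ifs with hk
    · obtain ⟨i, rfl⟩ := hk
      rw [← Nat.mul_succ, Nat.mul_div_cancel_left _ hm, Nat.mul_div_cancel_left _ hm,
        Nat.factorial_succ, Nat.succ_eq_add_one, pow_succ]
      have : (i.factorial : K) ≠ 0 := Nat.cast_ne_zero.2 i.factorial_ne_zero
      have : (i + 1 : K) ≠ 0 := Nat.cast_add_one_ne_zero i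
      push_cast
      field_simp
    · simp
  · rcases Nat.eq_zero_or_pos n with rfl | hn
    · simp [hmn]
    · simp [hmn, Nat.not_dvd_of_pos_of_lt hn (not_le.1 hmn)]

end CycleIndex

section ExponentialFormula

variable {x y : ℕ → ℂ}

lemma hasSum_cycleIndex_single {m : ℕ} (hm : 1 ≤ m) (c : ℂ) :
    HasSum (cycleIndex (Pi.single m c)) (Complex.exp (c / m))
      ∧ Summable fun j ↦ ‖cycleIndex (Pi.single m c) j‖ := by
  have hinj : Function.Injective (m * ·) := mul_right_injective₀ (by omega)
  have hcomp : cycleIndex (Pi.single m c) ∘ (m * ·) = fun k ↦ (c / m) ^ k / k.factorial := by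
    funext k
    simp [cycleIndex_single hm, Nat.mul_div_cancel_left _ (show 0 < m by omega)]
  have hzero : ∀ j ∉ Set.range (m * ·), cycleIndex (Pi.single m c) j = 0 := fun j hj ↦ by
    simp only [cycleIndex_single hm]
    exact if_neg fun ⟨k, hk⟩ ↦ hj ⟨k, hk.symm⟩
  constructor
  · rw [← hinj.hasSum_iff hzero, hcomp, Complex.exp_eq_exp_ℂ]
    exact NormedSpace.expSeries_div_hasSum_exp (c / m)
  · refine (hinj.summable_iff fun j hj ↦ by rw [hzero j hj, norm_zero]).1 ?_
    exact (NormedSpace.norm_expSeries_div_summable (c / m : ℂ)).congr fun k ↦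
      congrArg norm (congrFun hcomp k).symm

lemma hasSum_cycleIndex_add {a b : ℂ}
    (hx : HasSum (cycleIndex x) a ∧ Summable fun j ↦ ‖cycleIndex x j‖)
    (hy : HasSum (cycleIndex y) b ∧ Summable fun j ↦ ‖cycleIndex y j‖) :
    HasSum (cycleIndex (x + y)) (a * b) ∧ Summable fun j ↦ ‖cycleIndex (x + y) j‖ := by
  rw [funext (cycleIndex_add x y)]
  have hsum := summable_norm_sum_mul_antidiagonal_of_summable_norm hx.2 hy.2
  refine ⟨?_, hsum⟩
  rw [← hx.1.tsum_eq, ← hy.1.tsum_eq,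
    tsum_mul_tsum_eq_tsum_sum_antidiagonal_of_summable_norm hx.2 hy.2]
  exact hsum.of_norm.hasSum

lemma hasSum_cycleIndex {n : ℕ} (hx : ∀ m, n < m → x m = 0) :
    HasSum (cycleIndex x) (Complex.exp (∑ m ∈ Finset.Icc 1 n, x m / m))
      ∧ Summable fun j ↦ ‖cycleIndex x j‖ := by
  induction n generalizing x with
  | zero =>
    have h : cycleIndex x = cycleIndex (Pi.single 1 0) := funext fun j ↦
      cycleIndex_congr fun m hm ↦ by simp [hx m (Finset.mem_Icc.1 hm).1]
    simpa [h] using hasSum_cycleIndex_single le_rfl 0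
  | succ n ih =>
    have hsplit : x = Function.update x (n + 1) 0 + Pi.single (n + 1) (x (n + 1)) := by
      funext m
      by_cases hm : m = n + 1
      · subst hm; simp
      · simp [hm]
    have hlow : ∀ m ∈ Finset.Icc 1 n, Function.update x (n + 1) 0 m / m = x m / m := fun m hm ↦ by
      rw [Function.update_of_ne (by have := (Finset.mem_Icc.1 hm).2; omega)]
    have hzero : ∀ m, n < m → Function.update x (n + 1) 0 m = 0 := fun m hm ↦ by
      by_cases hm' : m = n + 1
      · subst hm'; simp
      · rw [Function.update_of_ne hm', hx m (by omega)]
    have h := hasSum_cycleIndex_add (ih hzero)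
      (hasSum_cycleIndex_single (Nat.le_add_left 1 n) (x (n + 1)))
    rwa [← hsplit, ← Complex.exp_add, Finset.sum_congr rfl hlow,
      ← Finset.sum_Icc_succ_top (Nat.le_add_left 1 n) (fun m ↦ x m / (m : ℂ))] at h

end ExponentialFormula

/-! ### The renewal recursion of the Feller coupling -/

section RisingCoeff

/-- The coefficients `θ (θ + 1) ⋯ (θ + n - 1) / n!` of `(1 - z) ^ (-θ)`. -/
noncomputable def risingCoeff (θ : ℝ) (n : ℕ) : ℝ :=
  (∏ i ∈ Finset.range n, (θ + i)) / n.factorial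

lemma risingCoeff_zero (θ : ℝ) : risingCoeff θ 0 = 1 := by simp [risingCoeff]

lemma risingCoeff_succ (θ : ℝ) (n : ℕ) :
    risingCoeff θ (n + 1) = risingCoeff θ n * ((θ + n) / (n + 1)) := by
  have h : (n.factorial : ℝ) ≠ 0 := Nat.cast_ne_zero.2 n.factorial_ne_zero
  rw [risingCoeff, risingCoeff, Finset.prod_range_succ, Nat.factorial_succ]
  push_cast
  field_simp

lemma mul_sum_risingCoeff (θ : ℝ) (n : ℕ) :
    θ * ∑ j ∈ Finset.range n, risingCoeff θ j = n * risingCoeff θ n := by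
  induction n with
  | zero => simp
  | succ n ih =>
    have h : (n + 1 : ℝ) ≠ 0 := by positivity
    rw [Finset.sum_range_succ, mul_add, ih, risingCoeff_succ]
    push_cast
    field_simp
    ring

lemma sum_Icc_sub {E : Type*} [AddCommMonoid E] (n : ℕ) (f : ℕ → E) :
    ∑ m ∈ Finset.Icc 1 n, f (n - m) = ∑ j ∈ Finset.range n, f j := by
  refine Finset.sum_bij' (fun m _ ↦ n - m) (fun j _ ↦ n - j) ?_ ?_ ?_ ?_ ?_ <;>
    simp only [Finset.mem_Icc, Finset.mem_range] <;> intros <;> first | omega | trivial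

lemma cycleIndex_const (θ : ℝ) : cycleIndex (fun _ ↦ θ) = risingCoeff θ := by
  refine (eq_cycleIndex_of_recursion (risingCoeff_zero θ) fun n ↦ ?_).symm
  rw [← Finset.mul_sum, sum_Icc_sub, mul_sum_risingCoeff]

lemma cycleIndex_const_complex (θ : ℝ) (n : ℕ) :
    cycleIndex (fun _ ↦ (θ : ℂ)) n = risingCoeff θ n := by
  rw [← cycleIndex_const, cycleIndex, cycleIndex, cycleAverage, cycleAverage]
  push_cast
  simp

variable {θ : ℝ}

lemma risingCoeff_pos (hθ : 0 < θ) (n : ℕ) : 0 < risingCoeff θ n :=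
  div_pos (Finset.prod_pos fun _ _ ↦ by positivity) (by positivity)

lemma tendsto_risingCoeff_ratio (hθ : 0 < θ) (m : ℕ) :
    Tendsto (fun n ↦ risingCoeff θ (n - m) / risingCoeff θ n) atTop (𝓝 1) := by
  rw [← tendsto_add_atTop_iff_nat m]
  simp_rw [Nat.add_sub_cancel]
  induction m with
  | zero => simp [div_self (risingCoeff_pos hθ _).ne']
  | succ m ih =>
    have one_step : Tendsto (fun n : ℕ ↦ ((n : ℝ) + (m + 1)) / (n + (θ + m))) atTop (𝓝 1) := by
      have := tendsto_add_mul_div_add_mul_atTop_nhds (m + 1 : ℝ) (θ + m) 1 one_ne_zero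
      simp only [one_mul, div_one] at this
      exact this.congr fun n ↦ by rw [add_comm (n : ℝ), add_comm (n : ℝ)]
    have h := ih.mul one_step
    rw [mul_one] at h
    refine h.congr fun n ↦ ?_
    have := risingCoeff_pos hθ (n + m)
    have : (0 : ℝ) < n + (θ + m) := by positivity
    have : (0 : ℝ) < n + m + 1 := by positivity
    have : (0 : ℝ) < θ + (n + m) := by positivity
    rw [← add_assoc n m 1, risingCoeff_succ]
    push_cast
    rw [div_mul_div_comm, ← mul_div_assoc, div_div_eq_mul_div]
    congr 1 <;> ring

end RisingCoeff

section EwensPGF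

variable {θ : ℝ}

/-- The joint probability generating function `E ∏ₘ ψₘ ^ Cₘ` of the cycle counts of an Ewens
permutation of `n` points. -/
noncomputable def ewensPGF (θ : ℝ) (ψ : ℕ → ℂ) (n : ℕ) : ℂ :=
  ∑ s : Equiv.Perm (Fin n), ewensWeight θ s * ∏ m ∈ Finset.Icc 1 n, ψ m ^ cycleCount m s

/-- The expected number of cycles of length `m` of an Ewens permutation of `n` points. -/
noncomputable def ewensMean (θ : ℝ) (n m : ℕ) : ℝ :=
  ∑ s : Equiv.Perm (Fin n), ewensWeight θ s * cycleCount m s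

lemma prod_pow_cycleCount {M : Type*} [CommMonoid M] {n : ℕ} (s : Equiv.Perm (Fin n))
    (x : ℕ → M) :
    ∏ m ∈ Finset.Icc 1 n, x m ^ cycleCount m s = (s.partition.parts.map x).prod := by
  rw [Finset.prod_multiset_map_count]
  refine (Finset.prod_subset (fun i hi ↦ ?_) fun i _ hi ↦ ?_).symm
  · have hi' := Multiset.mem_toFinset.1 hi
    refine Finset.mem_Icc.2 ⟨s.partition.parts_pos hi', ?_⟩
    simpa using s.partition.le_of_mem_parts hi'
  · rw [cycleCount, Multiset.count_eq_zero_of_notMem (by simpa using hi), pow_zero]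

lemma ewensPGF_eq_cycleIndex_div (θ : ℝ) (ψ : ℕ → ℂ) (n : ℕ) :
    ewensPGF θ ψ n = cycleIndex (fun m ↦ θ * ψ m) n / risingCoeff θ n := by
  have hn : (n.factorial : ℂ) ≠ 0 := Nat.cast_ne_zero.2 n.factorial_ne_zero
  rw [ewensPGF, cycleIndex, cycleAverage, risingCoeff]
  push_cast
  rw [div_div_div_cancel_right₀ hn, Finset.sum_div]
  refine Finset.sum_congr rfl fun s _ ↦ ?_
  rw [prod_pow_cycleCount, Multiset.prod_map_mul, ewensWeight, totalCycles, Multiset.map_const',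
    Multiset.prod_replicate]
  push_cast
  ring

lemma ewensMean_eq (θ : ℝ) {n m : ℕ} (hm : 1 ≤ m) (hmn : m ≤ n) :
    ewensMean θ n m = θ / m * (risingCoeff θ (n - m) / risingCoeff θ n) := by
  have hn : (n.factorial : ℝ) ≠ 0 := Nat.cast_ne_zero.2 n.factorial_ne_zero
  have remove_cycle : ewensMean θ n m = θ * cycleAverage n (fun s ↦
      s.count m * ((s.erase m).map fun _ ↦ θ).prod) / risingCoeff θ n := by
    rw [ewensMean, cycleAverage, risingCoeff, ← mul_div_assoc, div_div_div_cancel_right₀ hn,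
      Finset.mul_sum, Finset.sum_div]
    refine Finset.sum_congr rfl fun s _ ↦ ?_
    rw [ewensWeight, totalCycles, cycleCount, Multiset.map_const', Multiset.prod_replicate]
    by_cases hs : m ∈ s.partition.parts
    · rw [← Multiset.card_erase_add_one hs]
      ring
    · simp [Multiset.count_eq_zero_of_notMem hs]
  rw [remove_cycle, cycleAverage_count_mul_erase hm hmn fun s ↦ (s.map fun _ ↦ θ).prod,
    ← cycleIndex, cycleIndex_const]
  ring

/-- The probability that the last cycle of the Feller coupling of size `n` has length `m`: the
last success among independent trials `0, …, n - 1` with success probabilities `θ / (θ + i)` is at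
`n - m`. -/
noncomputable def lastCycleProb (θ : ℝ) (n m : ℕ) : ℝ :=
  θ / n * (risingCoeff θ (n - m) / risingCoeff θ n)

lemma lastCycleProb_nonneg (hθ : 0 < θ) (n m : ℕ) : 0 ≤ lastCycleProb θ n m := by
  have := risingCoeff_pos hθ (n - m)
  have := risingCoeff_pos hθ n
  unfold lastCycleProb
  positivity

lemma sum_lastCycleProb (hθ : 0 < θ) {n : ℕ} (hn : 1 ≤ n) :
    ∑ m ∈ Finset.Icc 1 n, lastCycleProb θ n m = 1 := by
  have := risingCoeff_pos hθ n
  have : (0 : ℝ) < n := by exact_mod_cast hn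
  simp_rw [lastCycleProb]
  rw [sum_Icc_sub n fun j ↦ θ / n * (risingCoeff θ j / risingCoeff θ n), ← Finset.mul_sum,
    ← Finset.sum_div, div_mul_div_comm, mul_sum_risingCoeff, div_self (by positivity)]

lemma lastCycleProb_succ_one (hθ : 0 < θ) (n : ℕ) :
    lastCycleProb θ (n + 1) 1 = θ / (θ + n) := by
  have := risingCoeff_pos hθ n
  have : (0 : ℝ) < θ + n := by positivity
  have : (0 : ℝ) < n + 1 := by positivity
  rw [lastCycleProb, risingCoeff_succ, Nat.add_sub_cancel]
  push_cast
  field_simp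

lemma lastCycleProb_succ_succ (hθ : 0 < θ) {n : ℕ} (hn : 1 ≤ n) (m : ℕ) :
    lastCycleProb θ (n + 1) (m + 1) = n / (θ + n) * lastCycleProb θ n m := by
  have := risingCoeff_pos hθ n
  have : (0 : ℝ) < θ + n := by positivity
  have : (0 : ℝ) < n + 1 := by positivity
  have : (0 : ℝ) < n := by exact_mod_cast hn
  rw [lastCycleProb, lastCycleProb, risingCoeff_succ, Nat.add_sub_add_right]
  push_cast
  field_simp

lemma ewensPGF_eq_sum_lastCycleProb (hθ : 0 < θ) (ψ : ℕ → ℂ) {n : ℕ} (hn : 1 ≤ n) :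
    ewensPGF θ ψ n
      = ∑ m ∈ Finset.Icc 1 n, lastCycleProb θ n m * (ψ m * ewensPGF θ ψ (n - m)) := by
  have hn' : (n : ℂ) ≠ 0 := Nat.cast_ne_zero.2 (by omega)
  have hd : ∀ k, (risingCoeff θ k : ℂ) ≠ 0 := fun k ↦
    Complex.ofReal_ne_zero.2 (risingCoeff_pos hθ k).ne'
  simp_rw [ewensPGF_eq_cycleIndex_div]
  rw [div_eq_iff (hd n), ← mul_right_inj' hn', natCast_mul_cycleIndex, Finset.sum_mul,
    Finset.mul_sum]
  refine Finset.sum_congr rfl fun m _ ↦ ?_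
  have := hd n
  have := hd (n - m)
  rw [lastCycleProb]
  push_cast
  field_simp

lemma norm_ewensPGF_le_one (hθ : 0 < θ) {ψ : ℕ → ℂ} (hψ : ∀ m, ‖ψ m‖ ≤ 1) (n : ℕ) :
    ‖ewensPGF θ ψ n‖ ≤ 1 := by
  induction n using Nat.strong_induction_on with
  | _ n ih =>
    rcases Nat.eq_zero_or_pos n with rfl | hn
    · simp [ewensPGF_eq_cycleIndex_div, cycleIndex_zero, risingCoeff_zero]
    · rw [ewensPGF_eq_sum_lastCycleProb hθ ψ hn, ← sum_lastCycleProb hθ hn]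
      refine norm_sum_le_of_le _ fun m hm ↦ ?_
      rw [norm_mul, norm_mul, Complex.norm_real, Real.norm_of_nonneg (lastCycleProb_nonneg hθ n m)]
      refine mul_le_of_le_one_right (lastCycleProb_nonneg hθ n m) ?_
      exact mul_le_one₀ (hψ m) (norm_nonneg _) (ih _ (by have := Finset.mem_Icc.1 hm; omega))

/-- The expectation of the product of `ψ` over the lengths of all cycles of the Feller coupling of
size `n` except the last one. These cycles stay in place when `n` grows. -/
noncomputable def completedPGF (θ : ℝ) (ψ : ℕ → ℂ) (n : ℕ) : ℂ :=
  ∑ m ∈ Finset.Icc 1 n, lastCycleProb θ n m * ewensPGF θ ψ (n - m)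

lemma norm_ewensPGF_sub_completedPGF_le (hθ : 0 < θ) {ψ : ℕ → ℂ} (hψ : ∀ m, ‖ψ m‖ ≤ 1)
    {n : ℕ} (hn : 1 ≤ n) :
    ‖ewensPGF θ ψ n - completedPGF θ ψ n‖
      ≤ ∑ m ∈ Finset.Icc 1 n, lastCycleProb θ n m * ‖ψ m - 1‖ := by
  rw [ewensPGF_eq_sum_lastCycleProb hθ ψ hn, completedPGF, ← Finset.sum_sub_distrib]
  refine norm_sum_le_of_le _ fun m _ ↦ ?_
  rw [← mul_sub, norm_mul, Complex.norm_real, Real.norm_of_nonneg (lastCycleProb_nonneg hθ n m),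
    ← sub_one_mul, norm_mul]
  exact mul_le_mul_of_nonneg_left (mul_le_of_le_one_right (norm_nonneg _)
    (norm_ewensPGF_le_one hθ hψ _)) (lastCycleProb_nonneg hθ n m)

lemma completedPGF_succ (hθ : 0 < θ) (ψ : ℕ → ℂ) {n : ℕ} (hn : 1 ≤ n) :
    completedPGF θ ψ (n + 1)
      = (θ / (θ + n) : ℝ) * ewensPGF θ ψ n + (n / (θ + n) : ℝ) * completedPGF θ ψ n := by
  rw [completedPGF, ← Finset.Ico_succ_right_eq_Icc, Order.succ_eq_add_one,
    Finset.sum_eq_sum_Ico_succ_bot (by omega), lastCycleProb_succ_one hθ, Nat.add_sub_cancel,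
    ← Finset.sum_Ico_add' _ 1 (n + 1) 1, completedPGF, Finset.mul_sum,
    ← Finset.Ico_succ_right_eq_Icc, Order.succ_eq_add_one]
  refine congrArg _ (Finset.sum_congr rfl fun m _ ↦ ?_)
  rw [lastCycleProb_succ_succ hθ hn, Nat.add_sub_add_right]
  push_cast
  ring

lemma completedPGF_succ_sub (hθ : 0 < θ) (ψ : ℕ → ℂ) {n : ℕ} (hn : 1 ≤ n) :
    completedPGF θ ψ (n + 1) - completedPGF θ ψ n
      = (θ / (θ + n) : ℝ) * (ewensPGF θ ψ n - completedPGF θ ψ n) := by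
  have : (θ + n : ℂ) ≠ 0 := by
    have : (θ + n : ℝ) ≠ 0 := by positivity
    exact_mod_cast this
  rw [completedPGF_succ hθ ψ hn]
  push_cast
  field_simp
  ring

lemma norm_sub_le_of_renewal {E : Type*} [NormedAddCommGroup E] {G M : ℕ → E} {c δ : ℕ → ℝ}
    {n N : ℕ} (hnN : n ≤ N) (hc : ∀ k, n ≤ k → 0 ≤ c k) (hGM : ∀ k, n ≤ k → ‖G k - M k‖ ≤ δ k)
    (hM : ∀ k, n ≤ k → ‖M (k + 1) - M k‖ ≤ c k * ‖G k - M k‖) :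
    ‖G N - G n‖ ≤ δ n + δ N + ∑ k ∈ Finset.Ico n N, c k * δ k := by
  have hMN : ‖M N - M n‖ ≤ ∑ k ∈ Finset.Ico n N, c k * δ k := by
    rw [← Finset.sum_Ico_sub M hnN]
    refine norm_sum_le_of_le _ fun k hk ↦ ?_
    have hk' := (Finset.mem_Ico.1 hk).1
    exact (hM k hk').trans (mul_le_mul_of_nonneg_left (hGM k hk') (hc k hk'))
  calc ‖G N - G n‖ = ‖(G N - M N) + (M N - M n) - (G n - M n)‖ := by congr 1; abel
    _ ≤ ‖G N - M N‖ + ‖M N - M n‖ + ‖G n - M n‖ :=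
      (norm_sub_le _ _).trans (add_le_add_left (norm_add_le _ _) _)
    _ ≤ _ := by linarith [hGM n le_rfl, hGM N hnN]

end EwensPGF

/-! ### Power bounds for the renewal weights -/

section PowerBounds

variable {α : ℝ}

lemma sub_one_rpow_le {a y : ℝ} (ha0 : 0 ≤ a) (ha1 : a ≤ 1) (hy : 1 ≤ y) :
    (y - 1) ^ a ≤ y ^ a * (1 - a / y) := by
  have hy0 : 0 < y := by linarith
  have hy1 : -1 ≤ -(1 / y) := by
    rw [neg_le_neg_iff, div_le_one hy0]
    exact hy
  have bernoulli := rpow_one_add_le_one_add_mul_self hy1 ha0 ha1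
  have factor : y - 1 = y * (1 + -(1 / y)) := by field_simp; ring
  rw [factor, Real.mul_rpow hy0.le (by linarith)]
  refine mul_le_mul_of_nonneg_left (bernoulli.trans (le_of_eq ?_)) (by positivity)
  ring

lemma sum_rpow_neg_le {s : ℝ} (hs0 : 0 ≤ s) (hs1 : s < 1) (n : ℕ) :
    ∑ j ∈ Finset.range n, ((j : ℝ) + 1) ^ (-s) ≤ (n : ℝ) ^ (1 - s) / (1 - s) := by
  have hs : 0 < 1 - s := by linarith
  induction n with
  | zero => simp [Real.zero_rpow hs.ne']
  | succ n ih =>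
    have hn : (0 : ℝ) < n + 1 := by positivity
    have split : ((n : ℝ) + 1) ^ (1 - s) = (n + 1) ^ (-s) * (n + 1) := by
      rw [← Real.rpow_add_one hn.ne']
      congr 1
      ring
    have increment : ((n : ℝ) + 1) ^ (1 - s) * (1 - (1 - s) / (n + 1))
        = (n + 1) ^ (1 - s) - (n + 1) ^ (-s) * (1 - s) := by
      rw [split]
      field_simp
    have h := sub_one_rpow_le hs.le (by linarith) (show (1 : ℝ) ≤ n + 1 by simp)
    rw [add_sub_cancel_right, increment] at h
    rw [Finset.sum_range_succ]
    push_cast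
    rw [le_div_iff₀ hs] at ih ⊢
    linarith

lemma rpow_neg_one_sub_le (hα0 : 0 < α) (hα1 : α ≤ 1) {x : ℝ} (hx : 1 ≤ x) :
    x ^ (-1 - α) ≤ 2 / α * (x ^ (-α) - (x + 1) ^ (-α)) := by
  have hx0 : 0 < x := by linarith
  have hx1 : 0 < x + 1 := by linarith
  have decrease : (x + 1) ^ (-α) ≤ x ^ (-α) * (1 - α / (x + 1)) := by
    have h := sub_one_rpow_le hα0.le hα1 (show 1 ≤ x + 1 by linarith)
    rw [add_sub_cancel_right] at h
    rwa [Real.rpow_neg hx1.le, Real.rpow_neg hx0.le, inv_mul_eq_div, le_div_iff₀ (by positivity),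
      inv_mul_le_iff₀ (by positivity)]
  calc x ^ (-1 - α) = x ^ (-α) * (1 / x) := by
        rw [mul_one_div, ← Real.rpow_sub_one hx0.ne']
        congr 1
        ring
    _ ≤ x ^ (-α) * (2 / (x + 1)) := by
        refine mul_le_mul_of_nonneg_left ?_ (by positivity)
        rw [div_le_div_iff₀ hx0 hx1]
        linarith
    _ = 2 / α * (x ^ (-α) * (α / (x + 1))) := by field_simp
    _ ≤ 2 / α * (x ^ (-α) - (x + 1) ^ (-α)) :=
        mul_le_mul_of_nonneg_left (by linarith) (by positivity)

lemma sum_rpow_neg_one_sub_le (hα0 : 0 < α) (hα1 : α ≤ 1) {n N : ℕ} (hn : 1 ≤ n) (hnN : n ≤ N) :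
    ∑ k ∈ Finset.Ico n N, (k : ℝ) ^ (-1 - α) ≤ 2 / α * (n : ℝ) ^ (-α) := by
  have telescope : ∑ k ∈ Finset.Ico n N, (k : ℝ) ^ (-1 - α)
      ≤ 2 / α * ((n : ℝ) ^ (-α) - (N : ℝ) ^ (-α)) := by
    rw [← neg_sub_neg (_ ^ (-α)), ← Finset.sum_Ico_sub (fun k : ℕ ↦ -(k : ℝ) ^ (-α)) hnN,
      Finset.mul_sum]
    refine Finset.sum_le_sum fun k hk ↦ ?_
    rw [neg_sub_neg]
    push_cast
    exact rpow_neg_one_sub_le hα0 hα1 (by exact_mod_cast hn.trans (Finset.mem_Ico.1 hk).1)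
  refine telescope.trans (mul_le_mul_of_nonneg_left ?_ (by positivity))
  have : (0 : ℝ) ≤ (N : ℝ) ^ (-α) := by positivity
  linarith

variable {θ : ℝ}

lemma risingCoeff_mul_rpow_mono (hθ : 0 < θ) (hα0 : 0 ≤ α) (hα1 : α ≤ 1) (hαθ : α ≤ θ) :
    Monotone fun j : ℕ ↦ risingCoeff θ j * (j : ℝ) ^ (1 - α) := by
  refine monotone_nat_of_le_succ fun j ↦ ?_
  have hj : (0 : ℝ) < j + 1 := by positivity
  have h := sub_one_rpow_le (a := 1 - α) (by linarith) (by linarith)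
    (show (1 : ℝ) ≤ j + 1 by simp)
  rw [add_sub_cancel_right] at h
  rw [risingCoeff_succ, mul_assoc]
  refine mul_le_mul_of_nonneg_left (h.trans ?_) (risingCoeff_pos hθ j).le
  push_cast
  rw [mul_comm]
  refine mul_le_mul_of_nonneg_right ?_ (by positivity)
  rw [one_sub_div hj.ne']
  gcongr
  linarith

lemma risingCoeff_mul_add_one_rpow_le (hθ : 0 < θ) (hα0 : 0 ≤ α) (hα1 : α ≤ 1) (hαθ : α ≤ θ)
    {j n : ℕ} (hjn : j < n) :
    risingCoeff θ j * ((j : ℝ) + 1) ^ (1 - α)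
      ≤ (2 + 1 / θ) * (risingCoeff θ n * (n : ℝ) ^ (1 - α)) := by
  have hmono := risingCoeff_mul_rpow_mono hθ hα0 hα1 hαθ
  have := risingCoeff_pos hθ n
  rcases Nat.eq_zero_or_pos j with rfl | hj
  · have h_one : risingCoeff θ 1 * ((1 : ℕ) : ℝ) ^ (1 - α) = θ := by simp [risingCoeff]
    have h := hmono hjn
    simp only [Nat.succ_eq_add_one, zero_add, h_one] at h
    calc risingCoeff θ 0 * (((0 : ℕ) : ℝ) + 1) ^ (1 - α) = 1 / θ * θ := by
          simp [risingCoeff_zero, hθ.ne']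
      _ ≤ (2 + 1 / θ) * (risingCoeff θ n * (n : ℝ) ^ (1 - α)) := by
          gcongr
          linarith
  · have hj1 : (1 : ℝ) ≤ j := by exact_mod_cast hj
    have hpow : ((j : ℝ) + 1) ^ (1 - α) ≤ 2 * (j : ℝ) ^ (1 - α) := by
      calc ((j : ℝ) + 1) ^ (1 - α) ≤ (2 * (j : ℝ)) ^ (1 - α) :=
            Real.rpow_le_rpow (by positivity) (by linarith) (by linarith)
        _ = 2 ^ (1 - α) * (j : ℝ) ^ (1 - α) := Real.mul_rpow (by norm_num) (by positivity)
        _ ≤ 2 * (j : ℝ) ^ (1 - α) := by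
            refine mul_le_mul_of_nonneg_right ?_ (by positivity)
            exact Real.rpow_le_self_of_one_le one_le_two (by linarith)
    calc risingCoeff θ j * ((j : ℝ) + 1) ^ (1 - α)
        ≤ risingCoeff θ j * (2 * (j : ℝ) ^ (1 - α)) :=
          mul_le_mul_of_nonneg_left hpow (risingCoeff_pos hθ j).le
      _ = 2 * (risingCoeff θ j * (j : ℝ) ^ (1 - α)) := by ring
      _ ≤ (2 + 1 / θ) * (risingCoeff θ n * (n : ℝ) ^ (1 - α)) := by
          exact mul_le_mul (le_add_of_nonneg_right (by positivity)) (hmono hjn.le)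
            (mul_nonneg (risingCoeff_pos hθ j).le (by positivity)) (by positivity)

/-- Up to a constant, a bound for the probability that the Feller couplings of sizes `n` and
`N ≥ n` differ in a cycle of length `m`. -/
noncomputable def couplingWeight (α : ℝ) (n m : ℕ) : ℝ :=
  (n : ℝ) ^ (-α) * (((n - m : ℕ) : ℝ) + 1) ^ (α - 1)

lemma couplingWeight_nonneg (α : ℝ) (n m : ℕ) : 0 ≤ couplingWeight α n m := by
  unfold couplingWeight
  positivity

lemma lastCycleProb_le (hθ : 0 < θ) (hα0 : 0 ≤ α) (hα1 : α ≤ 1) (hαθ : α ≤ θ) {n m : ℕ}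
    (hm : 1 ≤ m) (hmn : m ≤ n) :
    lastCycleProb θ n m ≤ (2 * θ + 1) * couplingWeight α n m := by
  have hn : (0 : ℝ) < n := by exact_mod_cast lt_of_lt_of_le hm hmn
  have hd := risingCoeff_pos hθ n
  have hj : (0 : ℝ) < ((n - m : ℕ) : ℝ) + 1 := by positivity
  have h := risingCoeff_mul_add_one_rpow_le hθ hα0 hα1 hαθ (show n - m < n by omega)
  rw [← le_div_iff₀ (by positivity)] at h
  calc lastCycleProb θ n m = θ / (n * risingCoeff θ n) * risingCoeff θ (n - m) := by
        rw [lastCycleProb]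
        field_simp
    _ ≤ θ / (n * risingCoeff θ n) * ((2 + 1 / θ) * (risingCoeff θ n * (n : ℝ) ^ (1 - α))
          / (((n - m : ℕ) : ℝ) + 1) ^ (1 - α)) := mul_le_mul_of_nonneg_left h (by positivity)
    _ = (2 * θ + 1) * ((n : ℝ) ^ (1 - α) / n * ((((n - m : ℕ) : ℝ) + 1) ^ (1 - α))⁻¹) := by
        field_simp
    _ = (2 * θ + 1) * couplingWeight α n m := by
        rw [couplingWeight, ← Real.rpow_sub_one hn.ne', ← Real.rpow_neg hj.le, neg_sub]
        congr 3
        ring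

lemma lastCycleProb_le_of_le (hθ : 0 < θ) (hα0 : 0 ≤ α) (hα1 : α ≤ 1) (hαθ : α ≤ θ)
    {n k m : ℕ} (hm : 1 ≤ m) (hmn : m ≤ n) (hnk : n ≤ k) :
    lastCycleProb θ k m
      ≤ (2 * θ + 1) * ((k : ℝ) ^ (-α) * (((n - m : ℕ) : ℝ) + 1) ^ (α - 1)) := by
  refine (lastCycleProb_le hθ hα0 hα1 hαθ hm (hmn.trans hnk)).trans ?_
  have hle : ((n - m : ℕ) : ℝ) ≤ (k - m : ℕ) := by exact_mod_cast Nat.sub_le_sub_right hnk m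
  refine mul_le_mul_of_nonneg_left (mul_le_mul_of_nonneg_left ?_ (by positivity)) (by positivity)
  exact Real.rpow_le_rpow_of_nonpos (by positivity) (by linarith) (by linarith)

/-- The constant in the comparison of the Feller couplings of different sizes. -/
noncomputable def couplingConst (θ α : ℝ) : ℝ := (2 * θ + 1) * (2 + θ * (2 / α))

lemma couplingConst_nonneg (hθ : 0 < θ) (hα0 : 0 < α) : 0 ≤ couplingConst θ α := by
  unfold couplingConst
  positivity

lemma renewal_error_le (hα0 : 0 < α) (hα1 : α ≤ 1) (hαθ : α ≤ θ) {n N m : ℕ} (hm : 1 ≤ m)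
    (hmn : m ≤ n) (hnN : n ≤ N) :
    lastCycleProb θ n m + lastCycleProb θ N m
        + ∑ k ∈ Finset.Ico n N, θ / (θ + k) * lastCycleProb θ k m
      ≤ couplingConst θ α * couplingWeight α n m := by
  have hθ := hα0.trans_le hαθ
  have hn : (0 : ℝ) < n := by exact_mod_cast lt_of_lt_of_le hm hmn
  have hlast : ∀ k, n ≤ k → _ := fun k hk ↦ lastCycleProb_le_of_le hθ hα0.le hα1 hαθ hm hmn hk
  set c : ℝ := (((n - m : ℕ) : ℝ) + 1) ^ (α - 1) with hc
  have hc0 : 0 ≤ c := by positivity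
  have last_N : lastCycleProb θ N m ≤ (2 * θ + 1) * ((n : ℝ) ^ (-α) * c) := by
    refine (hlast N hnN).trans ?_
    refine mul_le_mul_of_nonneg_left (mul_le_mul_of_nonneg_right ?_ hc0) (by positivity)
    exact Real.rpow_le_rpow_of_nonpos hn (by exact_mod_cast hnN) (by linarith)
  have between : ∑ k ∈ Finset.Ico n N, θ / (θ + k) * lastCycleProb θ k m
      ≤ (2 * θ + 1) * θ * c * ∑ k ∈ Finset.Ico n N, (k : ℝ) ^ (-1 - α) := by
    rw [Finset.mul_sum]
    refine Finset.sum_le_sum fun k hk ↦ ?_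
    have hnk := (Finset.mem_Ico.1 hk).1
    have hk0 : (0 : ℝ) < k := lt_of_lt_of_le hn (by exact_mod_cast hnk)
    calc θ / (θ + k) * lastCycleProb θ k m
        ≤ θ / k * ((2 * θ + 1) * ((k : ℝ) ^ (-α) * c)) := by
          refine mul_le_mul ?_ (hlast k hnk) (lastCycleProb_nonneg hθ k m) (by positivity)
          gcongr
          linarith
      _ = (2 * θ + 1) * θ * c * ((k : ℝ) ^ (-α) / k) := by ring
      _ = (2 * θ + 1) * θ * c * (k : ℝ) ^ (-1 - α) := by
          rw [← Real.rpow_sub_one hk0.ne']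
          congr 2
          ring
  have tail := mul_le_mul_of_nonneg_left (sum_rpow_neg_one_sub_le hα0 hα1 (hm.trans hmn) hnN)
    (show 0 ≤ (2 * θ + 1) * θ * c by positivity)
  refine (add_le_add (add_le_add (hlast n le_rfl) last_N) (between.trans tail)).trans_eq ?_
  rw [couplingConst, couplingWeight, ← hc]
  ring

lemma sum_renewal_error_le (hα0 : 0 < α) (hα1 : α ≤ 1) (hαθ : α ≤ θ) {n N : ℕ} (hnN : n ≤ N)
    {a : ℕ → ℝ} (ha : ∀ m, 0 ≤ a m) :
    (∑ m ∈ Finset.Icc 1 n, lastCycleProb θ n m * a m)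
        + (∑ m ∈ Finset.Icc 1 n, lastCycleProb θ N m * a m)
        + ∑ k ∈ Finset.Ico n N, θ / (θ + k) * ∑ m ∈ Finset.Icc 1 n, lastCycleProb θ k m * a m
      ≤ couplingConst θ α * ∑ m ∈ Finset.Icc 1 n, couplingWeight α n m * a m := by
  simp_rw [Finset.mul_sum]
  rw [Finset.sum_comm, ← Finset.sum_add_distrib, ← Finset.sum_add_distrib]
  refine Finset.sum_le_sum fun m hm ↦ ?_
  obtain ⟨hm1, hmn⟩ := Finset.mem_Icc.1 hm
  simp_rw [← mul_assoc]
  rw [← Finset.sum_mul, ← add_mul, ← add_mul]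
  exact mul_le_mul_of_nonneg_right (renewal_error_le hα0 hα1 hαθ hm1 hmn hnN) (ha m)

lemma sum_couplingWeight_rpow_le {q : ℝ} (hα1 : α ≤ 1) (hq : 1 ≤ q) (hαq : (1 - α) * q < 1)
    {n : ℕ} (hn : 1 ≤ n) :
    ∑ m ∈ Finset.Icc 1 n, (m : ℝ) ^ (q - 1) * couplingWeight α n m ^ q
      ≤ 1 / (1 - (1 - α) * q) := by
  have hn0 : (0 : ℝ) < n := by exact_mod_cast hn
  calc ∑ m ∈ Finset.Icc 1 n, (m : ℝ) ^ (q - 1) * couplingWeight α n m ^ q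
      ≤ ∑ m ∈ Finset.Icc 1 n, (n : ℝ) ^ (q - 1) * couplingWeight α n m ^ q := by
        refine Finset.sum_le_sum fun m hm ↦ ?_
        have hmn : (m : ℝ) ≤ n := by exact_mod_cast (Finset.mem_Icc.1 hm).2
        have := couplingWeight_nonneg α n m
        gcongr
    _ = ∑ m ∈ Finset.Icc 1 n, (n : ℝ) ^ (q - 1 - α * q)
          * (((n - m : ℕ) : ℝ) + 1) ^ (-((1 - α) * q)) := by
        refine Finset.sum_congr rfl fun m _ ↦ ?_
        have hj : (0 : ℝ) < ((n - m : ℕ) : ℝ) + 1 := by positivity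
        rw [couplingWeight, Real.mul_rpow (by positivity) (by positivity), ← Real.rpow_mul hn0.le,
          ← Real.rpow_mul hj.le, ← mul_assoc, ← Real.rpow_add hn0]
        congr 2 <;> ring
    _ = (n : ℝ) ^ (q - 1 - α * q) * ∑ j ∈ Finset.range n, ((j : ℝ) + 1) ^ (-((1 - α) * q)) := by
        rw [← Finset.mul_sum, sum_Icc_sub n fun j ↦ ((j : ℝ) + 1) ^ (-((1 - α) * q))]
    _ ≤ (n : ℝ) ^ (q - 1 - α * q) * ((n : ℝ) ^ (1 - (1 - α) * q) / (1 - (1 - α) * q)) :=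
        mul_le_mul_of_nonneg_left
          (sum_rpow_neg_le (mul_nonneg (by linarith) (by linarith)) hαq n) (by positivity)
    _ = 1 / (1 - (1 - α) * q) := by
        rw [← mul_div_assoc, ← Real.rpow_add hn0,
          show q - 1 - α * q + (1 - (1 - α) * q) = 0 by ring, Real.rpow_zero]

lemma sum_mul_le_of_holderConjugate {p q : ℝ} (hpq : p.HolderConjugate q) (n : ℕ) {w a : ℕ → ℝ}
    (hw : ∀ m, 0 ≤ w m) (ha : ∀ m, 0 ≤ a m) :
    ∑ m ∈ Finset.Icc 1 n, w m * a m
      ≤ (∑ m ∈ Finset.Icc 1 n, (m : ℝ) ^ (q - 1) * w m ^ q) ^ (1 / q)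
        * (∑ m ∈ Finset.Icc 1 n, 1 / (m : ℝ) * a m ^ p) ^ (1 / p) := by
  have hq0 : 0 < q := hpq.symm.pos
  have hp0 : 0 < p := hpq.pos
  have hqp : 1 / p * q = q - 1 := by
    have := hpq.inv_add_inv_eq_one
    field_simp at this ⊢
    linarith
  have hm0 : ∀ m ∈ Finset.Icc 1 n, (0 : ℝ) < m := fun m hm ↦ by
    exact_mod_cast (Finset.mem_Icc.1 hm).1
  have holder := Real.inner_le_Lp_mul_Lq_of_nonneg (Finset.Icc 1 n) hpq.symm
    (f := fun m : ℕ ↦ (m : ℝ) ^ (1 / p) * w m) (g := fun m ↦ (m : ℝ) ^ (-(1 / p)) * a m)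
    (fun m _ ↦ mul_nonneg (by positivity) (hw m)) (fun m _ ↦ mul_nonneg (by positivity) (ha m))
  refine (holder.trans_eq' (Finset.sum_congr rfl fun m hm ↦ ?_)).trans_eq ?_
  · rw [mul_mul_mul_comm, ← Real.rpow_add (hm0 m hm), add_neg_cancel, Real.rpow_zero, one_mul]
  · congr 2 <;> refine Finset.sum_congr rfl fun m hm ↦ ?_
    · rw [Real.mul_rpow (by positivity) (hw m), ← Real.rpow_mul (hm0 m hm).le, hqp]
    · rw [Real.mul_rpow (by positivity) (ha m), ← Real.rpow_mul (hm0 m hm).le,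
        show -(1 / p) * p = -1 by field_simp, Real.rpow_neg_one, one_div]

lemma exists_sum_couplingWeight_le {p : ℝ} (hα1 : α ≤ 1) (hp1 : 1 < p) (hpα : 1 / p < α) :
    ∃ K : ℝ, ∀ (n : ℕ) (a : ℕ → ℝ), 1 ≤ n → (∀ m, 0 ≤ a m) →
      ∑ m ∈ Finset.Icc 1 n, couplingWeight α n m * a m
        ≤ K * (∑ m ∈ Finset.Icc 1 n, 1 / (m : ℝ) * a m ^ p) ^ (1 / p) := by
  obtain ⟨q, hpq⟩ : ∃ q, p.HolderConjugate q := ⟨_, Real.HolderConjugate.conjExponent hp1⟩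
  have hq0 : 0 < q := hpq.symm.pos
  have hαq : (1 - α) * q < 1 := by
    have h_inv : 1 - α < q⁻¹ := by linarith [hpq.inv_add_inv_eq_one, one_div p]
    calc (1 - α) * q < q⁻¹ * q := mul_lt_mul_of_pos_right h_inv hq0
      _ = 1 := inv_mul_cancel₀ hq0.ne'
  refine ⟨(1 / (1 - (1 - α) * q)) ^ (1 / q), fun n a hn ha ↦ ?_⟩
  refine (sum_mul_le_of_holderConjugate hpq n (couplingWeight_nonneg α n) ha).trans ?_
  refine mul_le_mul_of_nonneg_right ?_ (Real.rpow_nonneg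
    (Finset.sum_nonneg fun m _ ↦ mul_nonneg (by positivity) (Real.rpow_nonneg (ha m) _)) _)
  refine Real.rpow_le_rpow (Finset.sum_nonneg fun m _ ↦ ?_)
    (sum_couplingWeight_rpow_le hα1 hpq.symm.lt.le hαq hn) (by positivity)
  have := couplingWeight_nonneg α n m
  positivity

end PowerBounds

/-! ### Comparison of the Ewens distribution with independent Poisson variables -/

section Comparison

variable {θ α : ℝ}

lemma ewensMean_succ_sub (hθ : 0 < θ) {k m : ℕ} (hm : 1 ≤ m) (hmk : m ≤ k) :
    (ewensMean θ (k + 1) m - lastCycleProb θ (k + 1) m) - (ewensMean θ k m - lastCycleProb θ k m)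
      = θ / (θ + k) * lastCycleProb θ k m := by
  have : (0 : ℝ) < m := by exact_mod_cast hm
  rw [ewensMean_eq θ hm (hmk.trans k.le_succ), ewensMean_eq θ hm hmk]
  obtain ⟨j, rfl⟩ := Nat.exists_eq_add_of_le hmk
  have := risingCoeff_pos hθ j
  have := risingCoeff_pos hθ (m + j)
  have : (0 : ℝ) < θ + (m + j) := by positivity
  have : (0 : ℝ) < m + j := by positivity
  have : (0 : ℝ) < m + j + 1 := by positivity
  simp only [lastCycleProb]
  rw [show m + j + 1 - m = j + 1 by omega, show m + j - m = j by omega, risingCoeff_succ,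
    risingCoeff_succ]
  push_cast
  field_simp
  ring

lemma abs_ewensMean_sub_le (hα0 : 0 < α) (hα1 : α ≤ 1) (hαθ : α ≤ θ) {n m : ℕ} (hm : 1 ≤ m)
    (hmn : m ≤ n) :
    |ewensMean θ n m - θ / m| ≤ couplingConst θ α * couplingWeight α n m := by
  have hθ := hα0.trans_le hαθ
  have mean_tendsto : Tendsto (fun N ↦ ewensMean θ N m) atTop (𝓝 (θ / m)) := by
    have h := (tendsto_risingCoeff_ratio hθ m).const_mul (θ / m)
    rw [mul_one] at h
    exact h.congr' ((eventually_ge_atTop m).mono fun N hN ↦ (ewensMean_eq θ hm hN).symm)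
  refine le_of_tendsto (tendsto_const_nhds.sub mean_tendsto).abs ?_
  filter_upwards [eventually_ge_atTop n] with N hN
  rw [abs_sub_comm, ← Real.norm_eq_abs]
  refine (norm_sub_le_of_renewal (G := fun k ↦ ewensMean θ k m)
    (M := fun k ↦ ewensMean θ k m - lastCycleProb θ k m) (δ := fun k ↦ lastCycleProb θ k m)
    (c := fun k ↦ θ / (θ + k)) hN (fun k _ ↦ by positivity) (fun k _ ↦ ?_)
    fun k hk ↦ ?_).trans (renewal_error_le hα0 hα1 hαθ hm hmn hN)
  · rw [sub_sub_cancel, Real.norm_of_nonneg (lastCycleProb_nonneg hθ k m)]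
  · rw [sub_sub_cancel, ewensMean_succ_sub hθ hm (hmn.trans hk), norm_mul,
      Real.norm_of_nonneg (show 0 ≤ θ / (θ + k) by positivity)]

lemma norm_ewensPGF_sub_le (hα0 : 0 < α) (hα1 : α ≤ 1) (hαθ : α ≤ θ) {ψ : ℕ → ℂ}
    (hψ : ∀ m, ‖ψ m‖ ≤ 1) {n N : ℕ} (hn : 1 ≤ n) (hnN : n ≤ N) (hψn : ∀ m, n < m → ψ m = 1) :
    ‖ewensPGF θ ψ N - ewensPGF θ ψ n‖
      ≤ couplingConst θ α * ∑ m ∈ Finset.Icc 1 n, couplingWeight α n m * ‖ψ m - 1‖ := by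
  have hθ := hα0.trans_le hαθ
  refine (norm_sub_le_of_renewal (M := completedPGF θ ψ) (c := fun k ↦ θ / (θ + k))
    (δ := fun k ↦ ∑ m ∈ Finset.Icc 1 n, lastCycleProb θ k m * ‖ψ m - 1‖) hnN
    (fun k _ ↦ by positivity) (fun k hk ↦ ?_) fun k hk ↦ ?_).trans
    (sum_renewal_error_le hα0 hα1 hαθ hnN fun m ↦ norm_nonneg _)
  · refine (norm_ewensPGF_sub_completedPGF_le hθ hψ (hn.trans hk)).trans_eq ?_
    refine (Finset.sum_subset (Finset.Icc_subset_Icc_right hk) fun m hm hm' ↦ ?_).symm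
    rw [hψn m (by simp only [Finset.mem_Icc] at hm hm'; omega), sub_self, norm_zero, mul_zero]
  · rw [completedPGF_succ_sub hθ ψ (hn.trans hk), norm_mul, Complex.norm_real,
      Real.norm_of_nonneg (show 0 ≤ θ / (θ + k) by positivity)]

lemma risingCoeff_ratio_le (hθ : 0 < θ) {j n : ℕ} (hjn : j ≤ n) :
    risingCoeff θ (n - j) / risingCoeff θ n ≤ (2 + 1 / θ) * (j + 1) := by
  have hn := risingCoeff_pos hθ n
  rcases Nat.eq_zero_or_pos j with rfl | hj
  · have : 0 < 1 / θ := by positivity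
    simp only [Nat.sub_zero, div_self hn.ne', CharP.cast_eq_zero, zero_add, mul_one]
    linarith
  · obtain ⟨k, rfl⟩ := Nat.exists_eq_add_of_le' hjn
    have h := risingCoeff_mul_add_one_rpow_le hθ le_rfl zero_le_one hθ.le
      (show k < k + j by omega)
    rw [sub_zero, Real.rpow_one, Real.rpow_one] at h
    have hk : (0 : ℝ) < k + 1 := by positivity
    rw [Nat.add_sub_cancel, div_le_iff₀ hn, ← mul_le_mul_iff_left₀ hk]
    refine h.trans ?_
    have : ((k + j : ℕ) : ℝ) ≤ (j + 1) * (k + 1) := by push_cast; nlinarith [k.cast_nonneg (α := ℝ)]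
    calc (2 + 1 / θ) * (risingCoeff θ (k + j) * (k + j : ℕ))
        ≤ (2 + 1 / θ) * (risingCoeff θ (k + j) * ((j + 1) * (k + 1))) := by gcongr
      _ = (2 + 1 / θ) * (j + 1) * risingCoeff θ (k + j) * (k + 1) := by ring

lemma summable_natCast_mul_norm_cycleIndex {x : ℕ → ℂ} {n : ℕ} (hx : ∀ m, n < m → x m = 0) :
    Summable fun j : ℕ ↦ j * ‖cycleIndex x j‖ := by
  have x_finite : Summable fun m ↦ ‖if m = 0 then 0 else x m‖ :=
    summable_of_ne_finset_zero (s := Finset.range (n + 1)) fun m hm ↦ by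
      rw [Finset.mem_range, not_lt] at hm
      rw [hx m (by omega), ite_self, norm_zero]
  refine (summable_norm_sum_mul_antidiagonal_of_summable_norm x_finite
    (hasSum_cycleIndex hx).2).congr fun j ↦ ?_
  rw [← sum_Icc_mul_eq_sum_antidiagonal, ← natCast_mul_cycleIndex, norm_mul, Complex.norm_natCast]

lemma tendsto_sum_antidiagonal_mul_risingCoeff_div (hθ : 0 < θ) {z : ℕ → ℂ}
    (hz : Summable fun j : ℕ ↦ (j + 1 : ℝ) * ‖z j‖) :
    Tendsto (fun N ↦ (∑ q ∈ Finset.HasAntidiagonal.antidiagonal N, z q.1 * risingCoeff θ q.2)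
      / (risingCoeff θ N : ℂ)) atTop (𝓝 (∑' j, z j)) := by
  set f : ℕ → ℕ → ℂ := fun N j ↦
    if j ≤ N then z j * ((risingCoeff θ (N - j) / risingCoeff θ N : ℝ) : ℂ) else 0 with hf
  have sum_eq : ∀ N, (∑ q ∈ Finset.HasAntidiagonal.antidiagonal N, z q.1 * risingCoeff θ q.2)
      / (risingCoeff θ N : ℂ) = ∑' j, f N j := fun N ↦ by
    rw [Finset.Nat.sum_antidiagonal_eq_sum_range_succ fun i j ↦ z i * (risingCoeff θ j : ℂ),
      Finset.sum_div, tsum_eq_sum (s := Finset.range N.succ) fun j hj ↦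
        if_neg (by simpa [Nat.lt_succ_iff] using hj)]
    refine Finset.sum_congr rfl fun j hj ↦ ?_
    rw [if_pos (Nat.lt_succ_iff.1 (Finset.mem_range.1 hj)), mul_div_assoc, Complex.ofReal_div]
  simp_rw [sum_eq]
  refine tendsto_tsum_of_dominated_convergence (hz.mul_left (2 + 1 / θ)) (fun j ↦ ?_)
    (Eventually.of_forall fun N j ↦ ?_)
  · have h := ((Complex.continuous_ofReal.tendsto _).comp
      (tendsto_risingCoeff_ratio hθ j)).const_mul (z j)
    rw [Complex.ofReal_one, mul_one] at h
    exact h.congr' ((eventually_ge_atTop j).mono fun N hN ↦ (if_pos hN).symm)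
  · simp only [hf]
    split_ifs with hj
    · have := risingCoeff_pos hθ (N - j)
      have := risingCoeff_pos hθ N
      rw [norm_mul, Complex.norm_real, Real.norm_of_nonneg (by positivity), ← mul_assoc, mul_comm]
      exact mul_le_mul_of_nonneg_right (risingCoeff_ratio_le hθ hj) (norm_nonneg _)
    · rw [norm_zero]
      positivity

lemma tendsto_ewensPGF (hθ : 0 < θ) {ψ : ℕ → ℂ} {n : ℕ} (hψn : ∀ m, n < m → ψ m = 1) :
    Tendsto (ewensPGF θ ψ) atTop
      (𝓝 (Complex.exp (∑ m ∈ Finset.Icc 1 n, θ / m * (ψ m - 1)))) := by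
  set x : ℕ → ℂ := fun m ↦ θ * (ψ m - 1) with hx
  have hx_zero : ∀ m, n < m → x m = 0 := fun m hm ↦ by
    rw [hx]
    dsimp only
    rw [hψn m hm, sub_self, mul_zero]
  obtain ⟨sum_z, summable_z⟩ := hasSum_cycleIndex hx_zero
  have hz : Summable fun j : ℕ ↦ (j + 1 : ℝ) * ‖cycleIndex x j‖ := by
    simp_rw [add_one_mul]
    exact (summable_natCast_mul_norm_cycleIndex hx_zero).add summable_z
  have limit := tendsto_sum_antidiagonal_mul_risingCoeff_div hθ hz
  rw [sum_z.tsum_eq] at limit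
  have exponent_eq : ∑ m ∈ Finset.Icc 1 n, (θ : ℂ) / m * (ψ m - 1)
      = ∑ m ∈ Finset.Icc 1 n, x m / m :=
    Finset.sum_congr rfl fun m _ ↦ div_mul_eq_mul_div _ _ _
  rw [exponent_eq]
  refine limit.congr fun N ↦ ?_
  have split : (fun m ↦ (θ : ℂ) * ψ m) = x + fun _ ↦ (θ : ℂ) := by
    ext m
    simp only [hx, Pi.add_apply]
    ring
  simp_rw [ewensPGF_eq_cycleIndex_div, split, cycleIndex_add, cycleIndex_const_complex]

lemma ewensPGF_congr {ψ χ : ℕ → ℂ} {n : ℕ} (h : ∀ m ∈ Finset.Icc 1 n, ψ m = χ m) :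
    ewensPGF θ ψ n = ewensPGF θ χ n :=
  Finset.sum_congr rfl fun _ _ ↦ congrArg _ (Finset.prod_congr rfl fun m hm ↦ by rw [h m hm])

lemma norm_ewensPGF_sub_exp_le (hα0 : 0 < α) (hα1 : α ≤ 1) (hαθ : α ≤ θ) {ψ : ℕ → ℂ}
    (hψ : ∀ m, ‖ψ m‖ ≤ 1) {n : ℕ} (hn : 1 ≤ n) :
    ‖ewensPGF θ ψ n - Complex.exp (∑ m ∈ Finset.Icc 1 n, θ / m * (ψ m - 1))‖
      ≤ couplingConst θ α * ∑ m ∈ Finset.Icc 1 n, couplingWeight α n m * ‖ψ m - 1‖ := by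
  set χ : ℕ → ℂ := fun m ↦ if m ≤ n then ψ m else 1 with hχ
  have χ_eq : ∀ m ∈ Finset.Icc 1 n, ψ m = χ m := fun m hm ↦ (if_pos (Finset.mem_Icc.1 hm).2).symm
  have χ_le : ∀ m, ‖χ m‖ ≤ 1 := fun m ↦ by
    simp only [hχ]
    split_ifs
    · exact hψ m
    · exact norm_one.le
  have χ_one : ∀ m, n < m → χ m = 1 := fun m hm ↦ if_neg hm.not_ge
  have exponent_eq : ∑ m ∈ Finset.Icc 1 n, (θ : ℂ) / m * (ψ m - 1)
      = ∑ m ∈ Finset.Icc 1 n, (θ : ℂ) / m * (χ m - 1) :=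
    Finset.sum_congr rfl fun m hm ↦ by rw [χ_eq m hm]
  have error_eq : ∑ m ∈ Finset.Icc 1 n, couplingWeight α n m * ‖ψ m - 1‖
      = ∑ m ∈ Finset.Icc 1 n, couplingWeight α n m * ‖χ m - 1‖ :=
    Finset.sum_congr rfl fun m hm ↦ by rw [χ_eq m hm]
  rw [ewensPGF_congr χ_eq, exponent_eq, error_eq]
  refine le_of_tendsto
    (tendsto_const_nhds.sub (tendsto_ewensPGF (hα0.trans_le hαθ) χ_one)).norm ?_
  filter_upwards [eventually_ge_atTop n] with N hN
  rw [norm_sub_rev]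
  exact norm_ewensPGF_sub_le hα0 hα1 hαθ χ_le hn hN χ_one

end Comparison

/-! ### Characteristic functions of triangular arrays -/

lemma norm_exp_mul_I_sub_le_of_abs_le_one {x : ℝ} (hx : |x| ≤ 1) :
    ‖Complex.exp (x * Complex.I) - 1 - x * Complex.I + x ^ 2 / 2‖ ≤ |x| ^ 3 := by
  have bound := Complex.exp_bound (x := x * Complex.I) (by simpa using hx) (n := 3) (by norm_num)
  have taylor : ∑ m ∈ Finset.range 3, ((x : ℂ) * Complex.I) ^ m / (m.factorial : ℂ)
      = 1 + x * Complex.I - x ^ 2 / 2 := by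
    simp only [Finset.sum_range_succ, Finset.sum_range_zero, Nat.factorial]
    push_cast
    rw [mul_pow (x : ℂ) Complex.I 2, Complex.I_sq]
    ring
  rw [taylor, norm_mul, Complex.norm_I, mul_one, Complex.norm_real, Real.norm_eq_abs] at bound
  rw [sub_sub, sub_add]
  refine bound.trans (mul_le_of_le_one_right (by positivity) ?_)
  norm_num [Nat.factorial]

lemma norm_exp_mul_I_sub_le_sq (x : ℝ) :
    ‖Complex.exp (x * Complex.I) - 1 - x * Complex.I + x ^ 2 / 2‖ ≤ 4 * x ^ 2 := by
  rcases le_total |x| 1 with hx | hx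
  · refine (norm_exp_mul_I_sub_le_of_abs_le_one hx).trans ?_
    rw [← sq_abs x]
    nlinarith [abs_nonneg x, sq_nonneg |x|]
  · have triangle : ‖Complex.exp (x * Complex.I) - 1 - x * Complex.I + x ^ 2 / 2‖
        ≤ 1 + 1 + |x| + x ^ 2 / 2 := by
      refine (norm_add_le _ _).trans (add_le_add ((norm_sub_le _ _).trans (add_le_add
        ((norm_sub_le _ _).trans (add_le_add (Complex.norm_exp_ofReal_mul_I x).le ?_)) ?_)) ?_)
      all_goals simp
    refine triangle.trans ?_
    rw [← sq_abs x]
    nlinarith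

lemma norm_exp_mul_I_sub_le {ε p : ℝ} (hε0 : 0 < ε) (hε1 : ε ≤ 1) (hp : 2 ≤ p) (x : ℝ) :
    ‖Complex.exp (x * Complex.I) - 1 - x * Complex.I + x ^ 2 / 2‖
      ≤ ε * x ^ 2 + 4 * ε ^ (2 - p) * |x| ^ p := by
  rcases le_or_gt |x| ε with hx | hx
  · have cubic := norm_exp_mul_I_sub_le_of_abs_le_one (hx.trans hε1)
    have : |x| ^ 3 ≤ ε * x ^ 2 := by
      rw [← sq_abs x, pow_succ, mul_comm]
      exact mul_le_mul_of_nonneg_right hx (by positivity)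
    have : 0 ≤ 4 * ε ^ (2 - p) * |x| ^ p := by positivity
    linarith
  · have hx0 : 0 < |x| := hε0.trans hx
    have : x ^ 2 ≤ ε ^ (2 - p) * |x| ^ p := by
      have hsq : x ^ 2 = |x| ^ (2 - p) * |x| ^ p := by
        rw [← Real.rpow_add hx0, sub_add_cancel, Real.rpow_two, sq_abs]
      rw [hsq]
      exact mul_le_mul_of_nonneg_right
        (Real.rpow_le_rpow_of_nonpos hε0 hx.le (by linarith)) (by positivity)
    have : 0 ≤ ε * x ^ 2 := by positivity
    linarith [norm_exp_mul_I_sub_le_sq x]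

section Moments

variable {Ω : Type*} [MeasurableSpace Ω] {P : Measure Ω} {Y : Ω → ℝ}

lemma integrable_abs_rpow {p : ℝ} (hp : 0 < p) (hY : MemLp Y (ENNReal.ofReal p) P) :
    Integrable (fun ω ↦ |Y ω| ^ p) P := by
  have := hY.integrable_norm_rpow (by simpa using hp) ENNReal.ofReal_ne_top
  simpa [ENNReal.toReal_ofReal hp.le] using this

lemma integrable_exp_mul_I [IsFiniteMeasure P] (hY : AEStronglyMeasurable Y P) :
    Integrable (fun ω ↦ Complex.exp (Y ω * Complex.I)) P :=
  Integrable.of_bound (Complex.continuous_exp.comp_aestronglyMeasurable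
    ((Complex.continuous_ofReal.comp_aestronglyMeasurable hY).mul_const _)) 1
    (Eventually.of_forall fun ω ↦ (Complex.norm_exp_ofReal_mul_I (Y ω)).le)

variable [IsProbabilityMeasure P]

lemma norm_integral_exp_mul_I_le_one (Y : Ω → ℝ) :
    ‖∫ ω, Complex.exp (Y ω * Complex.I) ∂P‖ ≤ 1 := by
  simpa using norm_integral_le_of_norm_le_const (μ := P)
    (Eventually.of_forall fun ω ↦ (Complex.norm_exp_ofReal_mul_I (Y ω)).le)

lemma norm_integral_exp_mul_I_sub_one_le (hY : Integrable Y P) :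
    ‖∫ ω, Complex.exp (Y ω * Complex.I) ∂P - 1‖ ≤ ∫ ω, |Y ω| ∂P := by
  have integral_eq : ∫ ω, Complex.exp (Y ω * Complex.I) ∂P - 1
      = ∫ ω, (Complex.exp (Y ω * Complex.I) - 1) ∂P := by
    rw [integral_sub (integrable_exp_mul_I hY.aestronglyMeasurable) (integrable_const _)]
    simp
  rw [integral_eq]
  refine norm_integral_le_of_norm_le hY.abs (Eventually.of_forall fun ω ↦ ?_)
  rw [mul_comm, ← Real.norm_eq_abs]
  exact Real.norm_exp_I_mul_ofReal_sub_one_le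

lemma integral_exp_mul_I_sub (hY : MemLp Y 2 P) :
    ∫ ω, (Complex.exp (Y ω * Complex.I) - 1 - Y ω * Complex.I + (Y ω : ℂ) ^ 2 / 2) ∂P
      = ∫ ω, Complex.exp (Y ω * Complex.I) ∂P - 1 - (∫ ω, Y ω ∂P : ℝ) * Complex.I
        + (∫ ω, Y ω ^ 2 ∂P : ℝ) / 2 := by
  have integrable_exp := integrable_exp_mul_I hY.aestronglyMeasurable
  have integrable_linear : Integrable (fun ω ↦ (Y ω : ℂ) * Complex.I) P :=
    (hY.integrable one_le_two).ofReal.mul_const _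
  have integrable_square : Integrable (fun ω ↦ (Y ω : ℂ) ^ 2 / 2) P := by
    simpa using (hY.integrable_sq.ofReal (𝕜 := ℂ)).div_const 2
  have integrable_exp_sub_one : Integrable (fun ω ↦ Complex.exp (Y ω * Complex.I) - 1) P :=
    integrable_exp.sub (integrable_const 1)
  have integrable_remainder : Integrable
      (fun ω ↦ Complex.exp (Y ω * Complex.I) - 1 - Y ω * Complex.I) P :=
    integrable_exp_sub_one.sub integrable_linear
  rw [integral_add integrable_remainder integrable_square,
    integral_sub integrable_exp_sub_one integrable_linear,
    integral_sub integrable_exp (integrable_const _), integral_mul_const, integral_div,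
    integral_complex_ofReal, ← integral_complex_ofReal (f := fun ω ↦ Y ω ^ 2)]
  simp

lemma norm_integral_exp_mul_I_sub_le {p : ℝ} (hp : 2 ≤ p) (hY : MemLp Y (ENNReal.ofReal p) P)
    {ε : ℝ} (hε0 : 0 < ε) (hε1 : ε ≤ 1) :
    ‖∫ ω, Complex.exp (Y ω * Complex.I) ∂P - 1 - (∫ ω, Y ω ∂P : ℝ) * Complex.I
        + (∫ ω, Y ω ^ 2 ∂P : ℝ) / 2‖
      ≤ ε * (∫ ω, Y ω ^ 2 ∂P) + 4 * ε ^ (2 - p) * ∫ ω, |Y ω| ^ p ∂P := by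
  have memLp_two : MemLp Y 2 P := hY.mono_exponent (ENNReal.ofNat_le_ofReal.2 hp)
  have integrable_sq := memLp_two.integrable_sq.const_mul ε
  have integrable_rpow := (integrable_abs_rpow (by linarith) hY).const_mul (4 * ε ^ (2 - p))
  rw [← integral_exp_mul_I_sub memLp_two, ← integral_const_mul, ← integral_const_mul,
    ← integral_add integrable_sq integrable_rpow]
  exact norm_integral_le_of_norm_le (integrable_sq.add integrable_rpow)
    (Eventually.of_forall fun ω ↦ norm_exp_mul_I_sub_le hε0 hε1 hp (Y ω))

lemma integral_abs_rpow_le {p : ℝ} (hp : 1 ≤ p) (hY : MemLp Y (ENNReal.ofReal p) P) :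
    (∫ ω, |Y ω| ∂P) ^ p ≤ ∫ ω, |Y ω| ^ p ∂P :=
  (convexOn_rpow hp).map_integral_le
    (Real.continuous_rpow_const (by linarith)).continuousOn isClosed_Ici
    (Eventually.of_forall fun ω ↦ abs_nonneg (Y ω))
    (hY.integrable (ENNReal.one_le_ofReal.2 hp)).abs (integrable_abs_rpow (by linarith) hY)

end Moments

section TriangularArray

variable {Ω : Type*} [MeasurableSpace Ω] {P : Measure Ω} {θ α p : ℝ}

/-- The harmonically weighted absolute moment `∑ₘ E|Zₘ|ᵖ / m` over `1 ≤ m ≤ n`, which controls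
both the comparison with Poisson variables and the Lyapunov condition. -/
noncomputable def harmonicMoment (P : Measure Ω) (p : ℝ) (Z : ℕ → Ω → ℝ) (n : ℕ) : ℝ :=
  ∑ m ∈ Finset.Icc 1 n, 1 / (m : ℝ) * ∫ ω, |Z m ω| ^ p ∂P

/-- The exponent `∑ₘ θ / m (E exp (i Zₘ) - 1)` over `1 ≤ m ≤ n` of the characteristic function of
the sum of the compound Poisson variables with jump distributions `Zₘ` and rates `θ / m`. -/
noncomputable def poissonExponent (P : Measure Ω) (θ : ℝ) (Z : ℕ → Ω → ℝ) (n : ℕ) : ℂ :=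
  ∑ m ∈ Finset.Icc 1 n, θ / m * (∫ ω, Complex.exp (Z m ω * Complex.I) ∂P - 1)

variable [IsProbabilityMeasure P]

lemma exists_sum_couplingWeight_integral_abs_le (hα1 : α ≤ 1) (hp1 : 1 < p) (hpα : 1 / p < α) :
    ∃ K : ℝ, ∀ (n : ℕ) (Z : ℕ → Ω → ℝ), 1 ≤ n →
      (∀ m, 1 ≤ m → MemLp (Z m) (ENNReal.ofReal p) P) →
      ∑ m ∈ Finset.Icc 1 n, couplingWeight α n m * ∫ ω, |Z m ω| ∂P
        ≤ K * harmonicMoment P p Z n ^ (1 / p) := by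
  obtain ⟨K, hK⟩ := exists_sum_couplingWeight_le hα1 hp1 hpα
  refine ⟨|K|, fun n Z hn hZ ↦ ?_⟩
  have abs_nonneg' : ∀ m, 0 ≤ ∫ ω, |Z m ω| ∂P := fun m ↦ integral_nonneg fun ω ↦ abs_nonneg _
  have sum_nonneg' : 0 ≤ ∑ m ∈ Finset.Icc 1 n, 1 / (m : ℝ) * (∫ ω, |Z m ω| ∂P) ^ p :=
    Finset.sum_nonneg fun m _ ↦ mul_nonneg (by positivity) (Real.rpow_nonneg (abs_nonneg' m) p)
  refine (hK n _ hn abs_nonneg').trans (mul_le_mul (le_abs_self K)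
    (Real.rpow_le_rpow sum_nonneg' (Finset.sum_le_sum fun m hm ↦ ?_) (by positivity))
    (Real.rpow_nonneg sum_nonneg' _) (abs_nonneg K))
  exact mul_le_mul_of_nonneg_left
    (integral_abs_rpow_le hp1.le (hZ m (Finset.mem_Icc.1 hm).1)) (by positivity)

lemma exists_norm_ewensPGF_sub_exp_poissonExponent_le (hα1 : α ≤ 1) (hαθ : α ≤ θ) (hp1 : 1 < p)
    (hpα : 1 / p < α) :
    ∃ K : ℝ, ∀ (n : ℕ) (Z : ℕ → Ω → ℝ), 1 ≤ n →
      (∀ m, 1 ≤ m → MemLp (Z m) (ENNReal.ofReal p) P) →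
      ‖ewensPGF θ (fun m ↦ ∫ ω, Complex.exp (Z m ω * Complex.I) ∂P) n
          - Complex.exp (poissonExponent P θ Z n)‖
        ≤ K * harmonicMoment P p Z n ^ (1 / p) := by
  obtain ⟨K, hK⟩ := exists_sum_couplingWeight_integral_abs_le (P := P) hα1 hp1 hpα
  have hα0 : 0 < α := lt_trans (by positivity) hpα
  refine ⟨couplingConst θ α * K, fun n Z hn hZ ↦ ?_⟩
  rw [mul_assoc]
  refine (norm_ewensPGF_sub_exp_le hα0 hα1 hαθ
    (fun m ↦ norm_integral_exp_mul_I_le_one _) hn).trans (mul_le_mul_of_nonneg_left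
    ((Finset.sum_le_sum fun m hm ↦ ?_).trans (hK n Z hn hZ))
    (couplingConst_nonneg (hα0.trans_le hαθ) hα0))
  exact mul_le_mul_of_nonneg_left (norm_integral_exp_mul_I_sub_one_le
    ((hZ m (Finset.mem_Icc.1 hm).1).integrable (ENNReal.one_le_ofReal.2 hp1.le)))
    (couplingWeight_nonneg α n m)

lemma exists_abs_sum_ewensMean_sub_le (hα1 : α ≤ 1) (hαθ : α ≤ θ) (hp1 : 1 < p)
    (hpα : 1 / p < α) :
    ∃ K : ℝ, ∀ (n : ℕ) (Z : ℕ → Ω → ℝ), 1 ≤ n →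
      (∀ m, 1 ≤ m → MemLp (Z m) (ENNReal.ofReal p) P) →
      |∑ m ∈ Finset.Icc 1 n, (ewensMean θ n m - θ / m) * ∫ ω, Z m ω ∂P|
        ≤ K * harmonicMoment P p Z n ^ (1 / p) := by
  obtain ⟨K, hK⟩ := exists_sum_couplingWeight_integral_abs_le (P := P) hα1 hp1 hpα
  have hα0 : 0 < α := lt_trans (by positivity) hpα
  have hC := couplingConst_nonneg (hα0.trans_le hαθ) hα0
  refine ⟨couplingConst θ α * K, fun n Z hn hZ ↦ ?_⟩
  rw [mul_assoc]
  refine le_trans ?_ (mul_le_mul_of_nonneg_left (hK n Z hn hZ) hC)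
  rw [Finset.mul_sum]
  refine (Finset.abs_sum_le_sum_abs _ _).trans (Finset.sum_le_sum fun m hm ↦ ?_)
  obtain ⟨hm1, hmn⟩ := Finset.mem_Icc.1 hm
  rw [abs_mul, ← mul_assoc]
  exact mul_le_mul (abs_ewensMean_sub_le hα0 hα1 hαθ hm1 hmn) abs_integral_le_integral_abs
    (abs_nonneg _) (mul_nonneg hC (couplingWeight_nonneg α n m))

lemma norm_poissonExponent_sub_le (hθ : 0 ≤ θ) (hp : 2 ≤ p) {Z : ℕ → Ω → ℝ}
    (hZ : ∀ m, 1 ≤ m → MemLp (Z m) (ENNReal.ofReal p) P) {ε : ℝ} (hε0 : 0 < ε) (hε1 : ε ≤ 1)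
    (n : ℕ) :
    ‖poissonExponent P θ Z n
        - (∑ m ∈ Finset.Icc 1 n, θ / m * ∫ ω, Z m ω ∂P : ℝ) * Complex.I
        + (θ * (∑ m ∈ Finset.Icc 1 n, 1 / (m : ℝ) * ∫ ω, Z m ω ^ 2 ∂P) / 2 : ℝ)‖
      ≤ θ * (ε * (∑ m ∈ Finset.Icc 1 n, 1 / (m : ℝ) * ∫ ω, Z m ω ^ 2 ∂P)
        + 4 * ε ^ (2 - p) * harmonicMoment P p Z n) := by
  have termwise : poissonExponent P θ Z n
        - (∑ m ∈ Finset.Icc 1 n, θ / m * ∫ ω, Z m ω ∂P : ℝ) * Complex.I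
        + (θ * (∑ m ∈ Finset.Icc 1 n, 1 / (m : ℝ) * ∫ ω, Z m ω ^ 2 ∂P) / 2 : ℝ)
      = ∑ m ∈ Finset.Icc 1 n, (θ / m : ℝ) * (∫ ω, Complex.exp (Z m ω * Complex.I) ∂P - 1
        - (∫ ω, Z m ω ∂P : ℝ) * Complex.I + (∫ ω, Z m ω ^ 2 ∂P : ℝ) / 2) := by
    rw [poissonExponent]
    push_cast
    rw [Finset.sum_mul, Finset.mul_sum, Finset.sum_div, ← Finset.sum_sub_distrib,
      ← Finset.sum_add_distrib]
    exact Finset.sum_congr rfl fun m _ ↦ by ring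
  rw [termwise, harmonicMoment, Finset.mul_sum, Finset.mul_sum, ← Finset.sum_add_distrib,
    Finset.mul_sum]
  refine norm_sum_le_of_le _ fun m hm ↦ ?_
  rw [norm_mul, Complex.norm_real, Real.norm_of_nonneg (by positivity)]
  refine (mul_le_mul_of_nonneg_left (norm_integral_exp_mul_I_sub_le hp
    (hZ m (Finset.mem_Icc.1 hm).1) hε0 hε1) (by positivity)).trans_eq ?_
  ring

variable {Z : ℕ → ℕ → Ω → ℝ} {v : ℝ}

lemma tendsto_poissonExponent_sub (hθ : 0 ≤ θ) (hp : 2 ≤ p)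
    (hZ : ∀ n m, 1 ≤ m → MemLp (Z n m) (ENNReal.ofReal p) P)
    (hv : Tendsto (fun n : ℕ ↦ θ * ∑ m ∈ Finset.Icc 1 n, 1 / (m : ℝ) * ∫ ω, Z n m ω ^ 2 ∂P)
      atTop (𝓝 v))
    (hmom : Tendsto (fun n ↦ harmonicMoment P p (Z n) n) atTop (𝓝 0)) :
    Tendsto (fun n ↦ poissonExponent P θ (Z n) n
      - (∑ m ∈ Finset.Icc 1 n, θ / m * ∫ ω, Z n m ω ∂P : ℝ) * Complex.I) atTop
      (𝓝 (-(v / 2 : ℝ))) := by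
  set D : ℕ → ℂ := fun n ↦ poissonExponent P θ (Z n) n
    - (∑ m ∈ Finset.Icc 1 n, θ / m * ∫ ω, Z n m ω ∂P : ℝ) * Complex.I
  set Q : ℕ → ℝ := fun n ↦ ∑ m ∈ Finset.Icc 1 n, 1 / (m : ℝ) * ∫ ω, Z n m ω ^ 2 ∂P
  have remainder_tendsto : Tendsto (fun n ↦ D n + (θ * Q n / 2 : ℝ)) atTop (𝓝 0) := by
    rw [Metric.tendsto_nhds]
    intro δ hδ
    obtain ⟨ε, ⟨hε0, hε1⟩, hε⟩ : ∃ ε : ℝ, (0 < ε ∧ ε ≤ 1) ∧ ε * v < δ := by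
      have small : ∀ᶠ ε in 𝓝[>] (0 : ℝ), ε * v < δ :=
        (((continuous_mul_const v).tendsto' 0 0 (zero_mul v)).mono_left
          nhdsWithin_le_nhds).eventually_lt_const hδ
      exact ((Filter.Eventually.and (Ioc_mem_nhdsGT one_pos) small).exists)
    have bound_tendsto : Tendsto
        (fun n ↦ θ * (ε * Q n + 4 * ε ^ (2 - p) * harmonicMoment P p (Z n) n)) atTop
        (𝓝 (ε * v)) := by
      refine ((hv.const_mul ε).add (hmom.const_mul (θ * (4 * ε ^ (2 - p))))).congr' ?_ |>.trans ?_
      · exact Eventually.of_forall fun n ↦ by ring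
      · simp
    filter_upwards [bound_tendsto.eventually_lt_const hε] with n hn
    rw [dist_zero_right]
    exact (norm_poissonExponent_sub_le hθ hp (hZ n) hε0 hε1 n).trans_lt hn
  have half_tendsto : Tendsto (fun n ↦ ((θ * Q n / 2 : ℝ) : ℂ)) atTop (𝓝 ((v / 2 : ℝ) : ℂ)) :=
    (Complex.continuous_ofReal.tendsto _).comp (hv.div_const 2)
  simpa only [add_sub_cancel_right, zero_sub] using remainder_tendsto.sub half_tendsto

lemma tendsto_ewensPGF_mul_exp (hp2 : 2 ≤ p) (hpθ : 1 / p < θ)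
    (hZ : ∀ n m, 1 ≤ m → MemLp (Z n m) (ENNReal.ofReal p) P)
    (hv : Tendsto (fun n : ℕ ↦ θ * ∑ m ∈ Finset.Icc 1 n, 1 / (m : ℝ) * ∫ ω, Z n m ω ^ 2 ∂P)
      atTop (𝓝 v))
    (hmom : Tendsto (fun n ↦ harmonicMoment P p (Z n) n) atTop (𝓝 0)) :
    Tendsto (fun n ↦ ewensPGF θ (fun m ↦ ∫ ω, Complex.exp (Z n m ω * Complex.I) ∂P) n
      * Complex.exp (-(∑ m ∈ Finset.Icc 1 n, ewensMean θ n m * ∫ ω, Z n m ω ∂P : ℝ) * Complex.I))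
      atTop (𝓝 (Complex.exp (-(v / 2 : ℝ)))) := by
  have hp1 : 1 < p := by linarith
  have hp0 : 0 < 1 / p := by positivity
  have hpα : 1 / p < min θ 1 := lt_min hpθ (by rwa [div_lt_one (by linarith)])
  obtain ⟨K, hK⟩ := exists_norm_ewensPGF_sub_exp_poissonExponent_le (P := P)
    (min_le_right θ 1) (min_le_left θ 1) hp1 hpα
  obtain ⟨K', hK'⟩ := exists_abs_sum_ewensMean_sub_le (P := P)
    (min_le_right θ 1) (min_le_left θ 1) hp1 hpα
  have error_tendsto : ∀ C, Tendsto (fun n ↦ C * harmonicMoment P p (Z n) n ^ (1 / p)) atTop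
      (𝓝 0) := fun C ↦ by
    have h := (hmom.rpow_const (Or.inr hp0.le)).const_mul C
    rwa [Real.zero_rpow hp0.ne', mul_zero] at h
  have mean_tendsto : Tendsto (fun n ↦
      ∑ m ∈ Finset.Icc 1 n, (ewensMean θ n m - θ / m) * ∫ ω, Z n m ω ∂P) atTop (𝓝 0) :=
    squeeze_zero_norm' ((eventually_ge_atTop 1).mono fun n hn ↦ hK' n _ hn (hZ n))
      (error_tendsto K')
  set κ : ℕ → ℝ := fun n ↦ ∑ m ∈ Finset.Icc 1 n, ewensMean θ n m * ∫ ω, Z n m ω ∂P with hκ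
  have exponent_tendsto : Tendsto (fun n ↦ poissonExponent P θ (Z n) n + -κ n * Complex.I) atTop
      (𝓝 (-(v / 2 : ℝ))) := by
    have h := (tendsto_poissonExponent_sub (hpθ.le.trans' hp0.le) hp2 hZ hv hmom).sub
      (((Complex.continuous_ofReal.tendsto 0).comp mean_tendsto).mul_const Complex.I)
    simp only [Complex.ofReal_zero, zero_mul, sub_zero] at h
    refine h.congr fun n ↦ ?_
    simp only [Function.comp_apply, sub_mul, Finset.sum_sub_distrib, hκ]
    push_cast
    ring
  have difference_tendsto : Tendsto (fun n ↦
      ewensPGF θ (fun m ↦ ∫ ω, Complex.exp (Z n m ω * Complex.I) ∂P) n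
          * Complex.exp (-κ n * Complex.I)
        - Complex.exp (poissonExponent P θ (Z n) n + -κ n * Complex.I)) atTop (𝓝 0) := by
    refine squeeze_zero_norm' ((eventually_ge_atTop 1).mono fun n hn ↦ ?_) (error_tendsto K)
    rw [Complex.exp_add, ← sub_mul, norm_mul, ← Complex.ofReal_neg,
      Complex.norm_exp_ofReal_mul_I, mul_one]
    exact hK n _ hn (hZ n)
  simpa only [sub_add_cancel, zero_add] using difference_tendsto.add exponent_tendsto.cexp

end TriangularArray

/-! ### Sums over the cycles of a random permutation -/

section FiniteSelection

lemma apply_eq_sum_indicator {Ω ι E : Type*} [Fintype ι] [AddCommMonoid E] (τ : Ω → ι)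
    (f : ι → Ω → E) (ω : Ω) : f (τ ω) ω = ∑ i, (τ ⁻¹' {i}).indicator (f i) ω := by
  classical simp [Set.indicator_apply]

variable {Ω 𝓧 ι E : Type*} [MeasurableSpace Ω] [MeasurableSpace 𝓧] [MeasurableSpace ι]
  [MeasurableSingletonClass ι] [NormedAddCommGroup E] {P : Measure Ω} {τ : Ω → ι}

lemma integrable_apply_of_finite [Finite ι] (hτ : Measurable τ) {f : ι → Ω → E}
    (hf : ∀ i, Integrable (f i) P) : Integrable (fun ω ↦ f (τ ω) ω) P := by
  have := Fintype.ofFinite ι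
  simp_rw [apply_eq_sum_indicator τ f]
  exact integrable_finsetSum _ fun i _ ↦ (hf i).indicator (hτ (measurableSet_singleton i))

lemma integral_apply_of_indepFun [Fintype ι] [NormedSpace ℝ E] (hτ : Measurable τ) {Z : Ω → 𝓧}
    (hZ : AEMeasurable Z P) (hind : IndepFun τ Z P) {F : ι → 𝓧 → E}
    (hF : ∀ i, StronglyMeasurable (F i)) (hFi : ∀ i, Integrable (fun ω ↦ F i (Z ω)) P) :
    ∫ ω, F (τ ω) (Z ω) ∂P = ∑ i, P.real (τ ⁻¹' {i}) • ∫ ω, F i (Z ω) ∂P := by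
  have hτi (i : ι) : MeasurableSet (τ ⁻¹' {i}) := hτ (measurableSet_singleton i)
  simp_rw [apply_eq_sum_indicator τ fun i ω ↦ F i (Z ω)]
  rw [integral_finsetSum _ fun i _ ↦ (hFi i).indicator (hτi i)]
  refine Finset.sum_congr rfl fun i _ ↦ ?_
  have as_product (ω : Ω) : (τ ⁻¹' {i}).indicator (fun ω ↦ F i (Z ω)) ω
      = ({i} : Set ι).indicator (1 : ι → ℝ) (τ ω) • F i (Z ω) := by
    by_cases h : τ ω = i <;> simp [h]
  simp_rw [as_product]
  rw [hind.integral_fun_comp_smul_comp hτ.aemeasurable hZ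
    (measurable_one.indicator (measurableSet_singleton i)).aestronglyMeasurable
    (hF i).aestronglyMeasurable]
  congr 1
  exact integral_indicator_one (hτi i)

end FiniteSelection

/-- The labels `(m, k)` of the cycles of `s`, where the cycles of length `m` are numbered
`k = 1, …, C_m`. Positive naturals are used because these label the random vectors. -/
def cycleLabels {n : ℕ} (s : Equiv.Perm (Fin n)) : Finset (ℕ+ × ℕ+) :=
  ((Finset.Icc 1 n).sigma fun m ↦ Finset.Icc 1 (cycleCount m s)).image
    fun i ↦ (i.1.toPNat', i.2.toPNat')

@[to_additive]
lemma prod_cycleLabels {M : Type*} [CommMonoid M] {n : ℕ} (s : Equiv.Perm (Fin n))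
    (f : ℕ → ℕ → M) :
    ∏ q ∈ cycleLabels s, f q.1 q.2
      = ∏ m ∈ Finset.Icc 1 n, ∏ k ∈ Finset.Icc 1 (cycleCount m s), f m k := by
  have coe_toPNat' {a b : ℕ} (ha : a ∈ Finset.Icc 1 b) : (a.toPNat' : ℕ) = a :=
    Nat.toPNat'_coe a ▸ if_pos (Finset.mem_Icc.1 ha).1
  rw [cycleLabels, Finset.prod_image, Finset.prod_sigma]
  · refine Finset.prod_congr rfl fun m hm ↦ Finset.prod_congr rfl fun k hk ↦ ?_
    rw [coe_toPNat' hm, coe_toPNat' hk]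
  · rintro ⟨m, k⟩ hi ⟨m', k'⟩ hi' h
    obtain ⟨hm, hk⟩ := Finset.mem_sigma.1 hi
    obtain ⟨hm', hk'⟩ := Finset.mem_sigma.1 hi'
    have eq_m := congrArg (fun q ↦ (q.1 : ℕ)) h
    have eq_k := congrArg (fun q ↦ (q.2 : ℕ)) h
    simp only [coe_toPNat' hm, coe_toPNat' hm', coe_toPNat' hk, coe_toPNat' hk'] at eq_m eq_k
    rw [eq_m, eq_k]

section CycleSum

instance (n : ℕ) : MeasurableSingletonClass (Equiv.Perm (Fin n)) :=
  ⟨fun _ ↦ MeasurableSpace.measurableSet_top⟩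

lemma cycleSum_eq_sum_cycleLabels {Ω : Type*} {d n : ℕ}
    {X : ℕ → ℕ → Ω → EuclideanSpace ℝ (Fin d)} (τ : Ω → Equiv.Perm (Fin n)) (ω : Ω) :
    cycleSum τ X ω = ∑ q ∈ cycleLabels (τ ω), X q.1 q.2 ω :=
  (sum_cycleLabels (τ ω) fun m k ↦ X m k ω).symm

variable {Ω : Type*} [MeasurableSpace Ω] {P : Measure Ω} {θ : ℝ} {d n : ℕ}
  {X : ℕ → ℕ → Ω → EuclideanSpace ℝ (Fin d)} {τ : Ω → Equiv.Perm (Fin n)}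

lemma IsEwens.measureReal_eq (hτ : IsEwens P θ τ) (hθ : 0 ≤ θ) (s : Equiv.Perm (Fin n)) :
    P.real (τ ⁻¹' {s}) = ewensWeight θ s := by
  rw [measureReal_def, hτ.prob_eq, ENNReal.toReal_ofReal]
  exact div_nonneg (by positivity) (Finset.prod_nonneg fun _ _ ↦ by positivity)

lemma charFun_map_sum_cycleLabels [IsProbabilityMeasure P]
    (hX_meas : ∀ m k, 1 ≤ m → 1 ≤ k → Measurable (X m k))
    (hX_indep : iIndepFun (fun (q : ℕ+ × ℕ+) ω ↦ X q.1 q.2 ω) P)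
    (hX_ident : ∀ m k, 1 ≤ m → 1 ≤ k → IdentDistrib (X m k) (X m 1) P P)
    (s : Equiv.Perm (Fin n)) (t : EuclideanSpace ℝ (Fin d)) :
    charFun (P.map fun ω ↦ ∑ q ∈ cycleLabels s, X q.1 q.2 ω) t
      = ∏ m ∈ Finset.Icc 1 n, charFun (P.map (X m 1)) t ^ cycleCount m s := by
  rw [iIndepFun.charFun_map_fun_finsetSum_eq_prod (X := fun q : ℕ+ × ℕ+ ↦ X q.1 q.2)
    (fun q _ ↦ (hX_meas _ _ q.1.2 q.2.2).aemeasurable) (hX_indep.restrict _), Finset.prod_apply]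
  simp_rw [fun q : ℕ+ × ℕ+ ↦ (hX_ident q.1 q.2 q.1.2 q.2.2).map_eq]
  rw [prod_cycleLabels s fun m _ ↦ charFun (P.map (X m 1)) t]
  simp only [Finset.prod_const, Nat.card_Icc, Nat.add_sub_cancel]

lemma measurable_sum_cycleLabels (hX_meas : ∀ m k, 1 ≤ m → 1 ≤ k → Measurable (X m k))
    (s : Equiv.Perm (Fin n)) : Measurable fun ω ↦ ∑ q ∈ cycleLabels s, X q.1 q.2 ω :=
  Finset.measurable_fun_sum _ fun q _ ↦ hX_meas _ _ q.1.2 q.2.2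

lemma measurable_cycleSum (hX_meas : ∀ m k, 1 ≤ m → 1 ≤ k → Measurable (X m k))
    (hτ : Measurable τ) : Measurable (cycleSum τ X) := by
  have joint : Measurable fun x : Equiv.Perm (Fin n) × Ω ↦ ∑ q ∈ cycleLabels x.1, X q.1 q.2 x.2 :=
    measurable_from_prod_countable_right (measurable_sum_cycleLabels hX_meas)
  have pair : Measurable fun ω ↦ (τ ω, ω) := hτ.prodMk measurable_id
  simpa only [Function.comp_def, ← cycleSum_eq_sum_cycleLabels] using joint.comp pair

theorem charFun_map_cycleSum [IsProbabilityMeasure P] (hθ : 0 ≤ θ)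
    (hX_meas : ∀ m k, 1 ≤ m → 1 ≤ k → Measurable (X m k))
    (hX_indep : iIndepFun (fun (q : ℕ+ × ℕ+) ω ↦ X q.1 q.2 ω) P)
    (hX_ident : ∀ m k, 1 ≤ m → 1 ≤ k → IdentDistrib (X m k) (X m 1) P P)
    (hτ : IsEwens P θ τ) (hτX : IndepFun τ (fun ω (q : ℕ+ × ℕ+) ↦ X q.1 q.2 ω) P)
    (t : EuclideanSpace ℝ (Fin d)) :
    charFun (P.map (cycleSum τ X)) t = ewensPGF θ (fun m ↦ charFun (P.map (X m 1)) t) n := by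
  have X_meas : Measurable fun ω (q : ℕ+ × ℕ+) ↦ X q.1 q.2 ω :=
    measurable_pi_lambda _ fun q ↦ hX_meas _ _ q.1.2 q.2.2
  rw [charFun_apply, integral_map (measurable_cycleSum hX_meas hτ.measurable).aemeasurable
    (by fun_prop)]
  simp_rw [cycleSum_eq_sum_cycleLabels]
  rw [integral_apply_of_indepFun hτ.measurable X_meas.aemeasurable hτX (F := fun s x ↦
    Complex.exp ((inner ℝ (∑ q ∈ cycleLabels s, x q) t : ℝ) * Complex.I)) (fun s ↦ by fun_prop)
    fun s ↦ integrable_exp_mul_I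
      ((measurable_sum_cycleLabels hX_meas s).inner measurable_const).aestronglyMeasurable,
    ewensPGF]
  refine Finset.sum_congr rfl fun s _ ↦ ?_
  rw [← charFun_map_sum_cycleLabels hX_meas hX_indep hX_ident, charFun_apply,
    integral_map (measurable_sum_cycleLabels hX_meas s).aemeasurable (by fun_prop),
    hτ.measureReal_eq hθ, Complex.real_smul]

lemma integrable_sum_cycleLabels
    (hX_ident : ∀ m k, 1 ≤ m → 1 ≤ k → IdentDistrib (X m k) (X m 1) P P)
    (hX_int : ∀ m, 1 ≤ m → Integrable (X m 1) P) (s : Equiv.Perm (Fin n)) :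
    Integrable (fun ω ↦ ∑ q ∈ cycleLabels s, X q.1 q.2 ω) P :=
  integrable_finsetSum _ fun q _ ↦
    (hX_ident q.1 q.2 q.1.2 q.2.2).integrable_iff.2 (hX_int q.1 q.1.2)

lemma integral_sum_cycleLabels
    (hX_ident : ∀ m k, 1 ≤ m → 1 ≤ k → IdentDistrib (X m k) (X m 1) P P)
    (hX_int : ∀ m, 1 ≤ m → Integrable (X m 1) P) (s : Equiv.Perm (Fin n)) :
    ∫ ω, ∑ q ∈ cycleLabels s, X q.1 q.2 ω ∂P
      = ∑ m ∈ Finset.Icc 1 n, (cycleCount m s : ℝ) • ∫ ω, X m 1 ω ∂P := by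
  rw [integral_finsetSum _ fun q _ ↦
    (hX_ident q.1 q.2 q.1.2 q.2.2).integrable_iff.2 (hX_int q.1 q.1.2)]
  simp_rw [fun q : ℕ+ × ℕ+ ↦ (hX_ident q.1 q.2 q.1.2 q.2.2).integral_eq]
  rw [sum_cycleLabels s fun m _ ↦ ∫ ω, X m 1 ω ∂P]
  simp only [Finset.sum_const, Nat.card_Icc, Nat.add_sub_cancel, Nat.cast_smul_eq_nsmul]

theorem integrable_cycleSum
    (hX_ident : ∀ m k, 1 ≤ m → 1 ≤ k → IdentDistrib (X m k) (X m 1) P P)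
    (hX_int : ∀ m, 1 ≤ m → Integrable (X m 1) P) (hτ : Measurable τ) :
    Integrable (cycleSum τ X) P := by
  refine (integrable_apply_of_finite hτ
    (integrable_sum_cycleLabels hX_ident hX_int)).congr (.of_forall fun ω ↦ ?_)
  exact (cycleSum_eq_sum_cycleLabels τ ω).symm

theorem integral_cycleSum (hθ : 0 ≤ θ)
    (hX_meas : ∀ m k, 1 ≤ m → 1 ≤ k → Measurable (X m k))
    (hX_ident : ∀ m k, 1 ≤ m → 1 ≤ k → IdentDistrib (X m k) (X m 1) P P)
    (hX_int : ∀ m, 1 ≤ m → Integrable (X m 1) P) (hτ : IsEwens P θ τ)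
    (hτX : IndepFun τ (fun ω (q : ℕ+ × ℕ+) ↦ X q.1 q.2 ω) P) :
    ∫ ω, cycleSum τ X ω ∂P
      = ∑ m ∈ Finset.Icc 1 n, ewensMean θ n m • ∫ ω, X m 1 ω ∂P := by
  simp_rw [cycleSum_eq_sum_cycleLabels]
  rw [integral_apply_of_indepFun hτ.measurable
    (measurable_pi_lambda _ fun q : ℕ+ × ℕ+ ↦ hX_meas q.1 q.2 q.1.2 q.2.2).aemeasurable hτX
    (F := fun s x ↦ ∑ q ∈ cycleLabels s, x q) (fun s ↦ by fun_prop)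
    fun s ↦ integrable_sum_cycleLabels hX_ident hX_int s]
  simp_rw [integral_sum_cycleLabels hX_ident hX_int, hτ.measureReal_eq hθ, ewensMean,
    Finset.sum_smul, Finset.smul_sum, smul_smul]
  exact Finset.sum_comm

end CycleSum

/-! ### Normalization and projections -/

section Normalization

variable {Ω : Type*} [MeasurableSpace Ω] {P : Measure Ω} {θ p v : ℝ} {V : ℕ → ℝ}

lemma harmonicMoment_const_mul (c : ℝ) (Y : ℕ → Ω → ℝ) (n : ℕ) :
    harmonicMoment P p (fun m ω ↦ c * Y m ω) n = |c| ^ p * harmonicMoment P p Y n := by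
  simp only [harmonicMoment, abs_mul, Real.mul_rpow (abs_nonneg _) (abs_nonneg _),
    integral_const_mul, Finset.mul_sum, mul_left_comm]

lemma harmonicMoment_nonneg (Y : ℕ → Ω → ℝ) (n : ℕ) : 0 ≤ harmonicMoment P p Y n :=
  Finset.sum_nonneg fun _ _ ↦ mul_nonneg (by positivity)
    (integral_nonneg fun _ ↦ Real.rpow_nonneg (abs_nonneg _) p)

lemma harmonicMoment_sum_le {ι : Type*} [Fintype ι] (hp : 1 ≤ p) {Y : ι → ℕ → Ω → ℝ}
    (hY : ∀ j m, 1 ≤ m → MemLp (Y j m) (ENNReal.ofReal p) P) (n : ℕ) :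
    harmonicMoment P p (fun m ω ↦ ∑ j, Y j m ω) n
      ≤ Fintype.card ι ^ (p - 1) * ∑ j, harmonicMoment P p (Y j) n := by
  have hp0 : 0 < p := by linarith
  have moment_le (m : ℕ) (hm : 1 ≤ m) : ∫ ω, |∑ j, Y j m ω| ^ p ∂P
      ≤ Fintype.card ι ^ (p - 1) * ∑ j, ∫ ω, |Y j m ω| ^ p ∂P := by
    have Y_int (j : ι) := integrable_abs_rpow hp0 (hY j m hm)
    rw [← integral_finsetSum _ fun j _ ↦ Y_int j, ← integral_const_mul]
    refine integral_mono (integrable_abs_rpow hp0 (memLp_finsetSum _ fun j _ ↦ hY j m hm))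
      ((integrable_finsetSum _ fun j _ ↦ Y_int j).const_mul _) fun ω ↦ ?_
    exact (Real.rpow_le_rpow (abs_nonneg _) (Finset.abs_sum_le_sum_abs _ _) hp0.le).trans
      (Real.rpow_sum_le_const_mul_sum_rpow Finset.univ (fun j ↦ Y j m ω) hp)
  simp only [harmonicMoment]
  rw [Finset.sum_comm, Finset.mul_sum]
  refine Finset.sum_le_sum fun m hm ↦ ?_
  rw [← Finset.mul_sum, mul_left_comm]
  exact mul_le_mul_of_nonneg_left (moment_le m (Finset.mem_Icc.1 hm).1) (by positivity)

lemma tendsto_harmonicMoment_inv_sqrt_mul (hθ : 0 < θ) (hV : Tendsto V atTop atTop)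
    {Y : ℕ → Ω → ℝ} (hmom : harmonicMoment P p Y =o[atTop] fun n ↦ V n ^ (p / 2)) :
    Tendsto (fun n ↦ harmonicMoment P p (fun m ω ↦ (√(θ * V n))⁻¹ * Y m ω) n) atTop (𝓝 0) := by
  have h := hmom.tendsto_div_nhds_zero.const_mul (θ ^ (p / 2))⁻¹
  rw [mul_zero] at h
  refine h.congr' ?_
  filter_upwards [hV.eventually_gt_atTop 0] with n hn
  rw [harmonicMoment_const_mul, abs_of_nonneg (by positivity), Real.inv_rpow (by positivity),
    Real.sqrt_eq_rpow, ← Real.rpow_mul (by positivity), one_div_mul_eq_div,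
    Real.mul_rpow hθ.le hn.le, mul_inv]
  ring

lemma tendsto_ewensPGF_normalized [IsProbabilityMeasure P] (hθ : 0 < θ) (hp2 : 2 ≤ p)
    (hpθ : 1 / p < θ) (hV : Tendsto V atTop atTop) {Y : ℕ → Ω → ℝ}
    (hY : ∀ m, 1 ≤ m → MemLp (Y m) (ENNReal.ofReal p) P)
    (hv : Tendsto (fun n : ℕ ↦ (∑ m ∈ Finset.Icc 1 n, 1 / (m : ℝ) * ∫ ω, Y m ω ^ 2 ∂P) / V n)
      atTop (𝓝 v))
    (hmom : harmonicMoment P p Y =o[atTop] fun n ↦ V n ^ (p / 2)) :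
    Tendsto (fun n ↦
      ewensPGF θ (fun m ↦ ∫ ω, Complex.exp (((√(θ * V n))⁻¹ * Y m ω : ℝ) * Complex.I) ∂P) n
        * Complex.exp (-(∑ m ∈ Finset.Icc 1 n,
          ewensMean θ n m * ∫ ω, (√(θ * V n))⁻¹ * Y m ω ∂P : ℝ) * Complex.I))
      atTop (𝓝 (Complex.exp (-(v / 2 : ℝ)))) := by
  refine tendsto_ewensPGF_mul_exp (Z := fun n m ω ↦ (√(θ * V n))⁻¹ * Y m ω) hp2 hpθ
    (fun n m hm ↦ (hY m hm).const_mul _) (hv.congr' ?_)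
    (tendsto_harmonicMoment_inv_sqrt_mul hθ hV hmom)
  filter_upwards [hV.eventually_gt_atTop 0] with n hn
  simp_rw [mul_pow, integral_const_mul, mul_left_comm _ ((√(θ * V n))⁻¹ ^ 2), ← Finset.mul_sum]
  rw [inv_pow, Real.sq_sqrt (by positivity)]
  field_simp

end Normalization

section Projection

variable {Ω ι : Type*} [MeasurableSpace Ω] [Fintype ι] {P : Measure Ω} {p : ℝ} {V : ℕ → ℝ}
  {Z : ℕ → Ω → EuclideanSpace ℝ ι} {S : Matrix ι ι ℝ}

lemma inner_eq_sum_mul {ι : Type*} [Fintype ι] (x t : EuclideanSpace ℝ ι) :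
    inner ℝ x t = ∑ j, t j * x j := by
  simp [PiLp.inner_apply]

lemma isLittleO_harmonicMoment_inner (hp : 1 ≤ p)
    (hZ : ∀ m, 1 ≤ m → MemLp (Z m) (ENNReal.ofReal p) P)
    (hmom : ∀ j, harmonicMoment P p (fun m ω ↦ Z m ω j) =o[atTop] fun n ↦ V n ^ (p / 2))
    (t : EuclideanSpace ℝ ι) :
    harmonicMoment P p (fun m ω ↦ inner ℝ (Z m ω) t) =o[atTop] fun n ↦ V n ^ (p / 2) := by
  have bound_isLittleO : (fun n ↦ Fintype.card ι ^ (p - 1) *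
      ∑ j, harmonicMoment P p (fun m ω ↦ t j * Z m ω j) n) =o[atTop] fun n ↦ V n ^ (p / 2) := by
    simp_rw [harmonicMoment_const_mul]
    exact (IsLittleO.fun_sum fun j _ ↦ (hmom j).const_mul_left _).const_mul_left _
  refine (IsBigO.of_norm_le fun n ↦ ?_).trans_isLittleO bound_isLittleO
  rw [Real.norm_of_nonneg (harmonicMoment_nonneg _ _)]
  simp_rw [inner_eq_sum_mul]
  exact harmonicMoment_sum_le hp (fun j m hm ↦ ((hZ m hm).eval_piLp j).const_mul (t j)) n

lemma integral_inner_sq {Y : Ω → EuclideanSpace ℝ ι} (hY : MemLp Y 2 P)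
    (t : EuclideanSpace ℝ ι) :
    ∫ ω, inner ℝ (Y ω) t ^ 2 ∂P = ∑ j, ∑ l, t j * t l * ∫ ω, Y ω j * Y ω l ∂P := by
  have mul_int (j l : ι) : Integrable (fun ω ↦ t j * t l * (Y ω j * Y ω l)) P :=
    ((hY.eval_piLp j).integrable_mul (hY.eval_piLp l)).const_mul _
  simp_rw [inner_eq_sum_mul, sq, Finset.sum_mul_sum, mul_mul_mul_comm]
  rw [integral_finsetSum _ fun j _ ↦ integrable_finsetSum _ fun l _ ↦ mul_int j l]
  simp_rw [integral_finsetSum _ fun l _ ↦ mul_int _ l, integral_const_mul]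

lemma tendsto_sum_integral_inner_sq (hZ : ∀ m, 1 ≤ m → MemLp (Z m) 2 P)
    (hS : ∀ j l, Tendsto (fun n : ℕ ↦
      (∑ m ∈ Finset.Icc 1 n, 1 / (m : ℝ) * ∫ ω, Z m ω j * Z m ω l ∂P) / V n) atTop (𝓝 (S j l)))
    (t : EuclideanSpace ℝ ι) :
    Tendsto (fun n : ℕ ↦
      (∑ m ∈ Finset.Icc 1 n, 1 / (m : ℝ) * ∫ ω, inner ℝ (Z m ω) t ^ 2 ∂P) / V n) atTop
      (𝓝 (t.ofLp ⬝ᵥ S.mulVec t.ofLp)) := by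
  have limit_eq : t.ofLp ⬝ᵥ S.mulVec t.ofLp = ∑ j, ∑ l, t j * t l * S j l := by
    simp only [dotProduct, Matrix.mulVec, Finset.mul_sum, mul_assoc, mul_comm (S _ _)]
  rw [limit_eq]
  refine (tendsto_finsetSum _ fun j _ ↦ tendsto_finsetSum _ fun l _ ↦
    (hS j l).const_mul (t j * t l)).congr fun n ↦ ?_
  rw [Finset.sum_congr rfl fun m hm ↦ congrArg _
    (integral_inner_sq (hZ m (Finset.mem_Icc.1 hm).1) t)]
  simp_rw [Finset.mul_sum, Finset.sum_div, Finset.mul_sum]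
  rw [Finset.sum_comm_cycle]
  exact Finset.sum_congr rfl fun m _ ↦ Finset.sum_congr rfl fun j _ ↦
    Finset.sum_congr rfl fun l _ ↦ by ring

lemma posSemidef_of_tendsto (hV : Tendsto V atTop atTop) (hZ : ∀ m, 1 ≤ m → MemLp (Z m) 2 P)
    (hS : ∀ j l, Tendsto (fun n : ℕ ↦
      (∑ m ∈ Finset.Icc 1 n, 1 / (m : ℝ) * ∫ ω, Z m ω j * Z m ω l ∂P) / V n)
      atTop (𝓝 (S j l))) :
    S.PosSemidef := by
  refine Matrix.PosSemidef.of_dotProduct_mulVec_nonneg ?_ fun x ↦ ?_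
  · ext j l
    rw [Matrix.conjTranspose_apply, star_trivial]
    refine tendsto_nhds_unique (hS l j) ((hS j l).congr fun n ↦ ?_)
    simp_rw [mul_comm (Z _ _ j)]
  · rw [star_trivial]
    refine ge_of_tendsto (tendsto_sum_integral_inner_sq hZ hS (WithLp.toLp 2 x)) ?_
    filter_upwards [hV.eventually_ge_atTop 0] with n hn
    exact div_nonneg (Finset.sum_nonneg fun m _ ↦
      mul_nonneg (by positivity) (integral_nonneg fun ω ↦ sq_nonneg _)) hn

end Projection

section CharFun

lemma charFun_multivariateGaussian_zero {ι : Type*} [Fintype ι] [DecidableEq ι]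
    {S : Matrix ι ι ℝ} (hS : S.PosSemidef) (t : EuclideanSpace ℝ ι) :
    charFun (multivariateGaussian 0 S) t
      = Complex.exp (-(t.ofLp ⬝ᵥ S.mulVec t.ofLp / 2 : ℝ)) := by
  simp [charFun_multivariateGaussian hS]

lemma charFun_map_smul_sub {Ω E : Type*} [MeasurableSpace Ω] {P : Measure Ω}
    [NormedAddCommGroup E] [InnerProductSpace ℝ E] [MeasurableSpace E] [BorelSpace E]
    [SecondCountableTopology E] {A : Ω → E} (hA : AEMeasurable A P) (c : ℝ) (a t : E) :
    charFun (P.map fun ω ↦ c • (A ω - a)) t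
      = charFun (P.map A) (c • t) * Complex.exp (-(inner ℝ a (c • t) : ℝ) * Complex.I) := by
  rw [charFun_map_smul_comp (hA.sub_const a), ← Complex.ofReal_neg, ← inner_neg_left,
    ← charFun_map_add_const, AEMeasurable.map_map_of_aemeasurable (by fun_prop) hA]
  simp only [Function.comp_def, sub_eq_add_neg]

variable {Ω : Type*} [MeasurableSpace Ω] {P : Measure Ω} [IsProbabilityMeasure P] {θ : ℝ}
  {d n : ℕ} {X : ℕ → ℕ → Ω → EuclideanSpace ℝ (Fin d)} {τ : Ω → Equiv.Perm (Fin n)}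

lemma charFun_map_smul_cycleSum_sub_integral (hθ : 0 ≤ θ)
    (hX_meas : ∀ m k, 1 ≤ m → 1 ≤ k → Measurable (X m k))
    (hX_indep : iIndepFun (fun (q : ℕ+ × ℕ+) ω ↦ X q.1 q.2 ω) P)
    (hX_ident : ∀ m k, 1 ≤ m → 1 ≤ k → IdentDistrib (X m k) (X m 1) P P)
    (hX_int : ∀ m, 1 ≤ m → Integrable (X m 1) P) (hτ : IsEwens P θ τ)
    (hτX : IndepFun τ (fun ω (q : ℕ+ × ℕ+) ↦ X q.1 q.2 ω) P) (c : ℝ)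
    (t : EuclideanSpace ℝ (Fin d)) :
    charFun (P.map fun ω ↦ c • (cycleSum τ X ω - ∫ ω', cycleSum τ X ω' ∂P)) t
      = ewensPGF θ (fun m ↦ ∫ ω, Complex.exp ((c * inner ℝ (X m 1 ω) t : ℝ) * Complex.I) ∂P) n
        * Complex.exp (-(∑ m ∈ Finset.Icc 1 n,
          ewensMean θ n m * ∫ ω, c * inner ℝ (X m 1 ω) t ∂P : ℝ) * Complex.I) := by
  have mean_eq : inner ℝ (∫ ω, cycleSum τ X ω ∂P) (c • t)
      = ∑ m ∈ Finset.Icc 1 n, ewensMean θ n m * ∫ ω, c * inner ℝ (X m 1 ω) t ∂P := by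
    rw [integral_cycleSum hθ hX_meas hX_ident hX_int hτ hτX, sum_inner]
    refine Finset.sum_congr rfl fun m hm ↦ ?_
    rw [real_inner_smul_left, real_inner_comm, ← integral_inner (hX_int m (Finset.mem_Icc.1 hm).1)]
    simp_rw [real_inner_smul_left, real_inner_comm]
  rw [charFun_map_smul_sub (measurable_cycleSum hX_meas hτ.measurable).aemeasurable, mean_eq,
    charFun_map_cycleSum hθ hX_meas hX_indep hX_ident hτ hτX]
  congr 1
  refine ewensPGF_congr fun m hm ↦ ?_
  rw [charFun_apply, integral_map
    (hX_meas m 1 (Finset.mem_Icc.1 hm).1 le_rfl).aemeasurable (by fun_prop)]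
  simp_rw [real_inner_smul_right]

end CharFun

end EwensCLT

theorem mainTheorem7 {Ω : Type*} [MeasurableSpace Ω] (P : Measure Ω) [IsProbabilityMeasure P]
    (θ : ℝ) (hθ : 0 < θ) (d : ℕ)
    -- the random vectors, with indices `m ≥ 1` and `k ≥ 1`
    (X : ℕ → ℕ → Ω → EuclideanSpace ℝ (Fin d))
    (hX_meas : ∀ m k : ℕ, 1 ≤ m → 1 ≤ k → Measurable (X m k))
    (hX_indep : iIndepFun (fun (q : ℕ+ × ℕ+) ω ↦ X q.1 q.2 ω) P)
    (hX_ident : ∀ m k : ℕ, 1 ≤ m → 1 ≤ k → IdentDistrib (X m k) (X m 1) P P)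
    -- for each `n`, an Ewens permutation of `n` points, independent of the random vectors
    (τ : (n : ℕ) → Ω → Equiv.Perm (Fin n))
    (hτ : ∀ n, EwensCLT.IsEwens P θ (τ n))
    (hτX : ∀ n, IndepFun (τ n) (fun ω (q : ℕ+ × ℕ+) ↦ X q.1 q.2 ω) P)
    (V : ℕ → ℝ) (hV : Tendsto V atTop atTop)
    (p : ℝ) (hp : max (1 / θ) 2 < p)
    (hX_Lp : ∀ m : ℕ, 1 ≤ m → ∀ j, MemLp (fun ω ↦ X m 1 ω j) (ENNReal.ofReal p) P)
    (S : Matrix (Fin d) (Fin d) ℝ)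
    (hS : ∀ j l, Tendsto
      (fun n : ℕ ↦ (∑ m ∈ Finset.Icc 1 n, (1 / (m : ℝ)) * ∫ ω, X m 1 ω j * X m 1 ω l ∂P) / V n)
      atTop (𝓝 (S j l)))
    (hX_mom : ∀ j,
      (fun n : ℕ ↦ ∑ m ∈ Finset.Icc 1 n, (1 / (m : ℝ)) * ∫ ω, |X m 1 ω j| ^ p ∂P)
        =o[atTop] fun n ↦ V n ^ (p / 2)) :
    S.PosSemidef ∧
    (∀ n, Integrable (EwensCLT.cycleSum (τ n) X) P) ∧
    TendstoInDistribution
      (fun (n : ℕ) ω ↦ (√(θ * V n))⁻¹ •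
        (EwensCLT.cycleSum (τ n) X ω - ∫ ω', EwensCLT.cycleSum (τ n) X ω' ∂P))
      atTop id (fun _ ↦ P) (multivariateGaussian 0 S) := by
  obtain ⟨hθp, hp2⟩ := max_lt_iff.1 hp
  have X_memLp : ∀ m, 1 ≤ m → MemLp (X m 1) (ENNReal.ofReal p) P :=
    fun m hm ↦ .of_eval_piLp (hX_Lp m hm)
  have X_memLp_two : ∀ m, 1 ≤ m → MemLp (X m 1) 2 P :=
    fun m hm ↦ (X_memLp m hm).mono_exponent (by simpa using ENNReal.ofReal_le_ofReal hp2.le)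
  have X_int : ∀ m, 1 ≤ m → Integrable (X m 1) P :=
    fun m hm ↦ (X_memLp_two m hm).integrable one_le_two
  have S_posSemidef : S.PosSemidef := EwensCLT.posSemidef_of_tendsto hV X_memLp_two hS
  have sum_measurable (n : ℕ) : Measurable (EwensCLT.cycleSum (τ n) X) :=
    EwensCLT.measurable_cycleSum hX_meas (hτ n).measurable
  refine ⟨S_posSemidef,
    fun n ↦ EwensCLT.integrable_cycleSum hX_ident X_int (hτ n).measurable,
    fun n ↦ by fun_prop, aemeasurable_id,
    ProbabilityMeasure.tendsto_iff_tendsto_charFun.2 fun t ↦ ?_⟩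
  simp only [ProbabilityMeasure.coe_mk, Measure.map_id]
  rw [EwensCLT.charFun_multivariateGaussian_zero S_posSemidef]
  simp_rw [EwensCLT.charFun_map_smul_cycleSum_sub_integral hθ.le hX_meas hX_indep hX_ident X_int
    (hτ _) (hτX _)]
  exact EwensCLT.tendsto_ewensPGF_normalized hθ hp2.le ((one_div_lt (by linarith) hθ).2 hθp) hV
    (fun m hm ↦ (X_memLp m hm).inner_const t) (EwensCLT.tendsto_sum_integral_inner_sq X_memLp_two
      hS t) (EwensCLT.isLittleO_harmonicMoment_inner (one_le_two.trans hp2.le) X_memLp hX_mom t)
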